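/- **Setting.** Let $(Q,\le_Q)$ be a quasi-order (qo) and let $V(Q)$ be the universe of well-founded sets with urelements from $Q$. The qo $\lesssim^*_Q$ on $V(Q)$ is defined recursively: $x\lesssim^*_Q y$ iff $x\le_Q y$ for $x,y\in Q$; an urelement compared with a set is replaced by its singleton; and for sets $x,y$: $\forall x'\in x\,\exists y'\in y\,(x'\lesssim^*_Q y')$. Its equivalence is $\sim^*_Q$. $\dot V^*_\alpha(Q)$ consists of the urelements and of the sets of rank $<\alpha$ that have an urelement in their transitive closure, where $\mathrm{rk}(x)\le\alpha$ iff every element of $x$ that is a set has rank $<\alpha$. For a set $S\subseteq V(Q)$, let $\dot{\mathcal I}^f(S)$ be the set of nonempty upward-directed $T\subseteq S$ of the form $T=\{z\in S:\forall a\in A\;(a\not\lesssim^*_Q z)\}$ with $A\subseteq S$ finite. Put $\hat I^*_\alpha(Q)=Q\cup\bigcup_{\beta<\alpha}\dot{\mathcal I}^f(\hat I^*_\beta(Q))$. If $Q$ carries a monoid operation $\cdot$, extend it to $V(Q)$ by replacing an urelement multiplied with a set by its singleton and by $x\cdot y=\{x'\cdot y':x'\in x,y'\in y\}$ for sets. For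 $x,y\in\hat I^*_\alpha(Q)$ let $x\,\hat\cdot\,y$ be a chosen $z\sim^*_Q x\cdot y$ in $\hat I^*_\gamma(Q)$, where $\gamma\le\alpha$ is least such that $\hat I^*_\gamma(Q)$ contains such a $z$, and $x\,\hat\cdot\,y=\emptyset$ if there is no such $\gamma\le\alpha$. Let $\mathrm{Prim}(\hat I^*_\alpha(Q))$ be the set of $x\in\hat I^*_\alpha(Q)$ such that $x\,\hat\cdot\,y\not\sim^*_Q y$ for some $y\in\hat I^*_\alpha(Q)$, and such that for all $y,z\in\hat I^*_\alpha(Q)$, $x\sim^*_Q y\,\hat\cdot\,z$ implies $x\sim^*_Q y$ or $x\sim^*_Q z$. A set $x$ is multiplicatively closed if for all $y,z\in x$ there is $w\in x$ with $y\cdot z\lesssim^*_Q w$. A *front* is an infinite family $F$ of finite subsets of $\omega$ (seen as increasing sequences), no member being a proper initial segment of another, such that every infinite $X\subseteq\bigcup F$ has an initial segment in $F$, together with an ordinal-valued rank function on the finite subsets of $\bigcup F$ that are proper initial segments of members of $F$, strictly decreasing along proper extension; the rank of $F$ is the rank of $\emptyset$. For nonempty finite $\sigma,\tau$ write $\sigma\triangleleft\tau$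 if $\min\sigma<\min\tau$ and one of $\sigma\setminus\{\min\sigma\}$, $\tau$ is an initial segment of the other. A qo $P$ is a *$\zeta$-wqo* if it is well-founded and for every front $F$ of rank $<\zeta$ and every $f:F\to P$ there are $\sigma\triangleleft\tau$ in $F$ with $f(\sigma)\le_P f(\tau)$. Let $P^{<\omega}$ be the set of finite sequences over a qo $P$, with embeddability as order and concatenation as product; identify $P$ with the sequences of length one. Let $P\sqcup\{\star\}$ be $P$ with a new element incomparable to all others. Put $D_\alpha=\bigcup_{\beta\le\alpha}\mathrm{Prim}(\hat I^*_\beta(P^{<\omega}))$ and define $f_\alpha$ on $D_\alpha$, with values in $V(P\sqcup\{\star\})\sqcup\{\bot\}$, by recursion: - $f_0(p)=p$ for $p\in P$. - $f_{\alpha+1}(x)$ is the value given by the first case that applies: 1. $f_\alpha(x)$, if $x\in D_\alpha$; 2. $\{f_\alpha(x'):x'\in x\cap D_\alpha\}$, if $x\sim^*_{P^{<\omega}}y$ for some $y\in\hat I^*_{\alpha+1}(P)$ and $f_\alpha(x')\ne\bot$ for all $x'\in x\cap D_\alpha$; 3. $\{f_\alpha(x'):x'\in x\cap D_\alpha\}\cup\{\star\}$,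 if $f_\alpha(x')\neq\bot$ for all $x'\in x\cap D_\alpha$ and $x\sim^*_{P^{<\omega}}y$ for some multiplicatively closed $y\in\dot{\mathcal I}^f(\hat I^*_\alpha(P^{<\omega}))$; 4. $\bot$, otherwise. - $f_\lambda=\bigcup_{\alpha<\lambda}f_\alpha$ for limit $\lambda$. **Theorem.** Let $\zeta$ be an ordinal and let $P$ be a $\zeta$-wqo. For every $\alpha<\zeta$: 1. $f_\alpha(x)\ne\bot$ for every $x\in D_\alpha$. 2. $f_\alpha$ maps $D_\alpha$ into $\dot V^*_\alpha(P\sqcup\{\star\})$ and is order-reflecting: for $x,y\in D_\alpha$, $f_\alpha(x)\lesssim^*_{P\sqcup\{\star\}}f_\alpha(y)$ implies $x\lesssim^*_{P^{<\omega}}y$. 3. $x\,\hat\cdot\,y\sim^*_{P^{<\omega}}x\cdot y$ for all $x,y\in\hat I^*_\alpha(P^{<\omega})$, and $(\hat I^*_\alpha(P^{<\omega}),\lesssim^*_{P^{<\omega}},\hat\cdot)$ is a multiplicative qo: it is a qo closed under $\hat\cdot$, and $\hat\cdot$ is associative up to $\sim^*_{P^{<\omega}}$, monotone in both arguments, and satisfies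 $x\lesssim^*_{P^{<\omega}}x\,\hat\cdot\,y$. 4. It has the $+$-property: if $a,b,c\in\hat I^*_\alpha(P^{<\omega})$ and $c\lesssim^*_{P^{<\omega}}a\,\hat\cdot\,b$, then there are $a'\lesssim^*_{P^{<\omega}}a$ and $b'\lesssim^*_{P^{<\omega}}b$ in $\hat I^*_\alpha(P^{<\omega})$ with $c\sim^*_{P^{<\omega}}a'\,\hat\cdot\,b'$. 5. Every $x\in\hat I^*_\alpha(P^{<\omega})$ is $\sim^*_{P^{<\omega}}$-equivalent to a finite $\hat\cdot$-product of elements of $\mathrm{Prim}(\hat I^*_\alpha(P^{<\omega}))$, the empty product being the empty sequence $\varepsilon$. -/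

import Mathlib

universe u

/-! ### Sets with urelements -/

/-- Well-founded trees of sets with urelements from `Q`, before extensionality is imposed. -/
inductive PreUSet (Q : Type u) : Type (u + 1)
  | atom (q : Q) : PreUSet Q
  | mk (ι : Type u) (A : ι → PreUSet Q) : PreUSet Q

namespace PreUSet

variable {Q : Type u}

/-- Extensional equality. -/
def Equiv : PreUSet Q → PreUSet Q → Prop
  | atom p, atom q => p = q
  | mk _ A, mk _ B => (∀ i, ∃ j, Equiv (A i) (B j)) ∧ (∀ j, ∃ i, Equiv (A i) (B j))
  | atom _, mk _ _ => False
  | mk _ _, atom _ => False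

theorem Equiv.refl : ∀ x : PreUSet Q, Equiv x x
  | atom _ => rfl
  | mk _ A => ⟨fun i => ⟨i, Equiv.refl (A i)⟩, fun i => ⟨i, Equiv.refl (A i)⟩⟩

theorem Equiv.symm : ∀ {x y : PreUSet Q}, Equiv x y → Equiv y x
  | atom _, atom _, h => Eq.symm h
  | mk _ _, mk _ _, ⟨h₁, h₂⟩ =>
    ⟨fun j => let ⟨i, h⟩ := h₂ j; ⟨i, Equiv.symm h⟩,
     fun i => let ⟨j, h⟩ := h₁ i; ⟨j, Equiv.symm h⟩⟩
  | atom _, mk _ _, h => False.elim h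
  | mk _ _, atom _, h => False.elim h

theorem Equiv.trans : ∀ {x y z : PreUSet Q}, Equiv x y → Equiv y z → Equiv x z
  | atom _, atom _, atom _, h, h' => Eq.trans h h'
  | mk _ _, mk _ _, mk _ _, ⟨h₁, h₂⟩, ⟨k₁, k₂⟩ =>
    ⟨fun i => let ⟨j, h⟩ := h₁ i; let ⟨k, h'⟩ := k₁ j; ⟨k, Equiv.trans h h'⟩,
     fun k => let ⟨j, h⟩ := k₂ k; let ⟨i, h'⟩ := h₂ j; ⟨i, Equiv.trans h' h⟩⟩
  | atom _, mk _ _, _, h, _ => False.elim h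
  | mk _ _, atom _, _, h, _ => False.elim h
  | _, atom _, mk _ _, _, h => False.elim h
  | _, mk _ _, atom _, _, h => False.elim h

instance setoid (Q : Type u) : Setoid (PreUSet Q) :=
  ⟨Equiv, Equiv.refl, Equiv.symm, Equiv.trans⟩

/-- `x` is a set, i.e. not an urelement. -/
def IsSet : PreUSet Q → Prop
  | atom _ => False
  | mk _ _ => True

theorem isSet_congr : ∀ {x y : PreUSet Q}, Equiv x y → (IsSet x ↔ IsSet y)
  | atom _, atom _, _ => Iff.rfl
  | mk _ _, mk _ _, _ => Iff.rfl
  | atom _, mk _ _, h => False.elim h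
  | mk _ _, atom _, h => False.elim h

/-- Membership; urelements have no elements. -/
def Mem (x : PreUSet Q) : PreUSet Q → Prop
  | atom _ => False
  | mk _ A => ∃ i, Equiv x (A i)

theorem mem_congr : ∀ {x x' y y' : PreUSet Q}, Equiv x x' → Equiv y y' → (Mem x y ↔ Mem x' y')
  | _, _, atom _, atom _, _, _ => Iff.rfl
  | _, _, mk _ _, mk _ _, h, ⟨k₁, k₂⟩ =>
    ⟨fun ⟨i, hi⟩ => let ⟨j, hj⟩ := k₁ i; ⟨j, (h.symm.trans hi).trans hj⟩,
     fun ⟨j, hj⟩ => let ⟨i, hi⟩ := k₂ j; ⟨i, (h.trans hj).trans hi.symm⟩⟩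
  | _, _, atom _, mk _ _, _, h => False.elim h
  | _, _, mk _ _, atom _, _, h => False.elim h

open Classical in
/-- The rank of a set; the value `0` at urelements is never used. -/
noncomputable def rank : PreUSet Q → Ordinal.{u}
  | atom _ => 0
  | mk _ A => ⨆ i, if IsSet (A i) then rank (A i) + 1 else 0

open Classical in
theorem rank_congr : ∀ {x y : PreUSet Q}, Equiv x y → rank x = rank y
  | atom _, atom _, _ => rfl
  | mk _ A, mk _ B, ⟨h₁, h₂⟩ => by
    have e : ∀ i j, Equiv (A i) (B j) →
        (if IsSet (A i) then rank (A i) + 1 else 0) =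
          (if IsSet (B j) then rank (B j) + 1 else 0) := by
      intro i j h
      rw [rank_congr h, if_congr (isSet_congr h) rfl rfl]
    refine le_antisymm (Ordinal.iSup_le fun i => ?_) (Ordinal.iSup_le fun j => ?_)
    · obtain ⟨j, hj⟩ := h₁ i
      rw [e i j hj]
      exact Ordinal.le_iSup (fun j => if IsSet (B j) then rank (B j) + 1 else 0) j
    · obtain ⟨i, hi⟩ := h₂ j
      rw [← e i j hi]
      exact Ordinal.le_iSup (fun i => if IsSet (A i) then rank (A i) + 1 else 0) i
  | atom _, mk _ _, h => False.elim h
  | mk _ _, atom _, h => False.elim h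

/-- The relation `q ≲ y` for an urelement `q`. -/
def atomLe [LE Q] (p : Q) : PreUSet Q → Prop
  | atom q => p ≤ q
  | mk _ B => ∃ j, atomLe p (B j)

/-- The relation `x ≲ y`. -/
def le [LE Q] : PreUSet Q → PreUSet Q → Prop
  | atom p, y => atomLe p y
  | mk _ A, atom q => ∀ i, le (A i) (atom q)
  | mk _ A, mk _ B => ∀ i, ∃ j, le (A i) (B j)

theorem atomLe_congr [LE Q] (p : Q) :
    ∀ {y y' : PreUSet Q}, Equiv y y' → (atomLe p y ↔ atomLe p y')
  | atom _, atom _, h => by cases h; exact Iff.rfl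
  | mk _ _, mk _ _, ⟨h₁, h₂⟩ =>
    ⟨fun ⟨i, hi⟩ => let ⟨j, hj⟩ := h₁ i; ⟨j, (atomLe_congr p hj).1 hi⟩,
     fun ⟨j, hj⟩ => let ⟨i, hi⟩ := h₂ j; ⟨i, (atomLe_congr p hi).2 hj⟩⟩
  | atom _, mk _ _, h => False.elim h
  | mk _ _, atom _, h => False.elim h

theorem le_congr [LE Q] : ∀ {x x' y y' : PreUSet Q},
    Equiv x x' → Equiv y y' → (le x y ↔ le x' y')
  | atom _, atom _, _, _, h, h' => by cases h; exact atomLe_congr _ h'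
  | mk _ A, mk _ A', atom q, atom q', ⟨h₁, h₂⟩, h' =>
    ⟨fun H i => let ⟨j, hj⟩ := h₂ i; (le_congr hj h').1 (H j),
     fun H i => let ⟨j, hj⟩ := h₁ i; (le_congr hj h').2 (H j)⟩
  | mk _ _, mk _ _, mk _ _, mk _ _, ⟨h₁, h₂⟩, ⟨k₁, k₂⟩ =>
    ⟨fun H i => let ⟨j, hj⟩ := h₂ i; let ⟨k, hk⟩ := H j; let ⟨l, hl⟩ := k₁ k
      ⟨l, (le_congr hj hl).1 hk⟩,
     fun H i => let ⟨j, hj⟩ := h₁ i; let ⟨k, hk⟩ := H j; let ⟨l, hl⟩ := k₂ k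
      ⟨l, (le_congr hj hl).2 hk⟩⟩
  | atom _, mk _ _, _, _, h, _ => False.elim h
  | mk _ _, atom _, _, _, h, _ => False.elim h
  | _, _, atom _, mk _ _, _, h => False.elim h
  | _, _, mk _ _, atom _, _, h => False.elim h

/-- The product `p · y` for an urelement `p`. -/
def atomMul [Mul Q] (p : Q) : PreUSet Q → PreUSet Q
  | atom q => atom (p * q)
  | mk κ B => mk κ fun j => atomMul p (B j)

/-- The product `x · y`. -/
def mul [Mul Q] : PreUSet Q → PreUSet Q → PreUSet Q
  | atom p, y => atomMul p y
  | mk ι A, atom q => mk ι fun i => mul (A i) (atom q)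
  | mk ι A, mk κ B => mk (ι × κ) fun k => mul (A k.1) (B k.2)

theorem atomMul_congr [Mul Q] (p : Q) :
    ∀ {y y' : PreUSet Q}, Equiv y y' → Equiv (atomMul p y) (atomMul p y')
  | atom _, atom _, h => congrArg (p * ·) h
  | mk _ _, mk _ _, ⟨h₁, h₂⟩ =>
    ⟨fun i => let ⟨j, hj⟩ := h₁ i; ⟨j, atomMul_congr p hj⟩,
     fun j => let ⟨i, hi⟩ := h₂ j; ⟨i, atomMul_congr p hi⟩⟩
  | atom _, mk _ _, h => False.elim h
  | mk _ _, atom _, h => False.elim h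

theorem mul_congr [Mul Q] : ∀ {x x' y y' : PreUSet Q},
    Equiv x x' → Equiv y y' → Equiv (mul x y) (mul x' y')
  | atom _, atom _, _, _, h, h' => by cases h; exact atomMul_congr _ h'
  | mk _ A, mk _ A', atom q, atom q', ⟨h₁, h₂⟩, h' =>
    ⟨fun i => let ⟨j, hj⟩ := h₁ i; ⟨j, mul_congr hj h'⟩,
     fun j => let ⟨i, hi⟩ := h₂ j; ⟨i, mul_congr hi h'⟩⟩
  | mk _ _, mk _ _, mk _ _, mk _ _, ⟨h₁, h₂⟩, ⟨k₁, k₂⟩ =>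
    ⟨fun i => let ⟨j, hj⟩ := h₁ i.1; let ⟨l, hl⟩ := k₁ i.2; ⟨(j, l), mul_congr hj hl⟩,
     fun i => let ⟨j, hj⟩ := h₂ i.1; let ⟨l, hl⟩ := k₂ i.2; ⟨(j, l), mul_congr hj hl⟩⟩
  | atom _, mk _ _, _, _, h, _ => False.elim h
  | mk _ _, atom _, _, _, h, _ => False.elim h
  | _, _, atom _, mk _ _, _, h => False.elim h
  | _, _, mk _ _, atom _, _, h => False.elim h

end PreUSet

/-- The universe `V(Q)` of well-founded sets with urelements from `Q`. -/
def USet (Q : Type u) : Type (u + 1) := Quotient (PreUSet.setoid Q)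

namespace USet

variable {Q : Type u}

/-- The object of the universe given by a tree. -/
def mk (a : PreUSet Q) : USet Q := Quotient.mk _ a

theorem mk_eq_mk {a b : PreUSet Q} : mk a = mk b ↔ PreUSet.Equiv a b :=
  ⟨fun h => Quotient.exact h, fun h => Quotient.sound h⟩

theorem ind {motive : USet Q → Prop} (h : ∀ a, motive (mk a)) (x : USet Q) : motive x :=
  Quotient.ind h x

/-- An urelement, as an object of the universe. -/
def atom (q : Q) : USet Q := mk (PreUSet.atom q)

/-- `x` is a set, i.e. not an urelement. -/
def IsSet (x : USet Q) : Prop :=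
  Quotient.liftOn x PreUSet.IsSet fun _ _ h => propext (PreUSet.isSet_congr h)

instance : Membership (USet Q) (USet Q) where
  mem y x := Quotient.liftOn₂ x y PreUSet.Mem
    fun _ _ _ _ h h' => propext (PreUSet.mem_congr h h')

/-- The collection of elements of `x`. -/
def elems (x : USet Q) : Set (USet Q) := {y | y ∈ x}

/-- The rank of a set with urelements: `rank x ≤ α` iff all elements of `x` that are sets have
rank `< α`. It is only meaningful at sets. -/
noncomputable def rank (x : USet Q) : Ordinal.{u} :=
  Quotient.liftOn x PreUSet.rank fun _ _ h => PreUSet.rank_congr h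

/-- The quasi-order `x ≲ y`. -/
instance [LE Q] : LE (USet Q) where
  le x y := Quotient.liftOn₂ x y PreUSet.le fun _ _ _ _ h h' => propext (PreUSet.le_congr h h')

/-- The equivalence relation `x ∼ y` induced by `≲`. -/
def Equi [LE Q] (x y : USet Q) : Prop := x ≤ y ∧ y ≤ x

/-- The extension of the product of `Q` to all sets with urelements. -/
instance [Mul Q] : Mul (USet Q) where
  mul x y := Quotient.liftOn₂ x y (fun a b => mk (PreUSet.mul a b))
    fun _ _ _ _ h h' => Quotient.sound (PreUSet.mul_congr h h')

/-- The set with a given small collection of elements. -/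
noncomputable def ofSet (S : Set (USet Q)) [Small.{u} S] : USet Q :=
  mk (PreUSet.mk (Shrink.{u} S) fun i => Quotient.out ((equivShrink S).symm i).1)

noncomputable instance : EmptyCollection (USet Q) := ⟨ofSet ∅⟩

noncomputable instance : Singleton (USet Q) (USet Q) := ⟨fun x => ofSet {x}⟩

/-! Basic facts showing that these notions are the intended ones. -/

@[simp] theorem isSet_ofSet (S : Set (USet Q)) [Small.{u} S] : (ofSet S).IsSet := trivial

@[simp] theorem not_isSet_atom (q : Q) : ¬ (atom q).IsSet := fun h => h

theorem isSet_iff {x : USet Q} : x.IsSet ↔ ∀ q, x ≠ atom q := by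
  induction x using USet.ind with | _ a => ?_
  cases a with
  | atom q => exact iff_of_false (fun h => h) (fun h => h q rfl)
  | mk ι A => exact iff_of_true trivial fun q h => Quotient.exact h

theorem atom_injective : Function.Injective (atom : Q → USet Q) :=
  fun _ _ h => Quotient.exact h

@[simp] theorem notMem_atom (x : USet Q) (q : Q) : x ∉ atom q := by
  induction x using USet.ind with | _ a => exact fun h => h

theorem mem_mk {ι : Type u} {A : ι → PreUSet Q} {x : USet Q} :
    x ∈ mk (PreUSet.mk ι A) ↔
      ∃ i, x = mk (A i) := by
  induction x using USet.ind with | _ a => ?_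
  exact exists_congr fun i => ⟨fun h => Quotient.sound h, fun h => Quotient.exact h⟩

@[simp] theorem mem_ofSet {S : Set (USet Q)} [Small.{u} S] {x : USet Q} :
    x ∈ ofSet S ↔ x ∈ S := by
  unfold ofSet
  rw [mem_mk]
  have e : ∀ y : USet Q, mk (Quotient.out y) = y := fun y => Quotient.out_eq y
  simp only [e]
  constructor
  · rintro ⟨i, rfl⟩
    exact ((equivShrink S).symm i).2
  · intro h
    exact ⟨equivShrink S ⟨x, h⟩, by simp⟩

@[simp] theorem notMem_empty (x : USet Q) : x ∉ (∅ : USet Q) := by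
  change x ∉ ofSet ∅
  simp

@[simp] theorem mem_singleton {x y : USet Q} : x ∈ ({y} : USet Q) ↔ x = y := by
  change x ∈ ofSet {y} ↔ _
  simp

@[simp] theorem isSet_singleton (x : USet Q) : ({x} : USet Q).IsSet := trivial

/-- Extensionality for sets. -/
theorem ext_of_isSet {x y : USet Q} (hx : x.IsSet) (hy : y.IsSet)
    (h : ∀ z, z ∈ x ↔ z ∈ y) : x = y := by
  induction x using USet.ind with | _ a => ?_
  induction y using USet.ind with | _ b => ?_
  cases a with
  | atom q => exact hx.elim
  | mk ι A =>
    cases b with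
    | atom q => exact hy.elim
    | mk κ B =>
      refine Quotient.sound ⟨fun i => ?_, fun j => ?_⟩
      · obtain ⟨j, hj⟩ := mem_mk.1 ((h _).1 (mem_mk.2 ⟨i, rfl⟩))
        exact ⟨j, mk_eq_mk.1 hj⟩
      · obtain ⟨i, hi⟩ := mem_mk.1 ((h _).2 (mem_mk.2 ⟨j, rfl⟩))
        exact ⟨i, mk_eq_mk.1 hi.symm⟩

instance small_elems (x : USet Q) : Small.{u} x.elems := by
  induction x using USet.ind with | _ a => ?_
  cases a with
  | atom q =>
    have : (mk (PreUSet.atom q)).elems = ∅ :=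
      Set.eq_empty_iff_forall_notMem.2 fun x => notMem_atom x q
    rw [this]; infer_instance
  | mk ι A =>
    have : (mk (PreUSet.mk ι A)).elems =
        Set.range fun i => mk (A i) := by
      ext x
      exact mem_mk.trans (exists_congr fun _ => eq_comm)
    rw [this]; infer_instance

theorem rank_le_iff {x : USet Q} (hx : x.IsSet) {α : Ordinal.{u}} :
    x.rank ≤ α ↔ ∀ y ∈ x, y.IsSet → y.rank < α := by
  induction x using USet.ind with | _ a => ?_
  cases a with
  | atom q => exact hx.elim
  | mk ι A =>
    change (⨆ i, _) ≤ α ↔ _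
    rw [Ordinal.iSup_le_iff]
    constructor
    · intro h y hy hs
      obtain ⟨i, rfl⟩ := mem_mk.1 hy
      have := h i
      rw [if_pos (show (A i).IsSet from hs)] at this
      exact Order.add_one_le_iff.1 this
    · intro h i
      split_ifs with hs
      · exact Order.add_one_le_iff.2 (h _ (mem_mk.2 ⟨i, rfl⟩) hs)
      · exact zero_le

section LE

variable [LE Q]

@[simp] theorem atom_le_atom {p q : Q} : atom p ≤ atom q ↔ p ≤ q := Iff.rfl

theorem le_iff_of_isSet {x y : USet Q} (hx : x.IsSet) (hy : y.IsSet) :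
    x ≤ y ↔ ∀ x' ∈ x, ∃ y' ∈ y, x' ≤ y' := by
  induction x using USet.ind with | _ a => ?_
  induction y using USet.ind with | _ b => ?_
  cases a with
  | atom q => exact hx.elim
  | mk ι A =>
    cases b with
    | atom q => exact hy.elim
    | mk κ B =>
      constructor
      · intro h x' hx'
        obtain ⟨i, rfl⟩ := mem_mk.1 hx'
        obtain ⟨j, hj⟩ := h i
        exact ⟨_, mem_mk.2 ⟨j, rfl⟩, hj⟩
      · intro h i
        obtain ⟨y', hy', h'⟩ := h _ (mem_mk.2 ⟨i, rfl⟩)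
        obtain ⟨j, rfl⟩ := mem_mk.1 hy'
        exact ⟨j, h'⟩

theorem le_atom_iff {x : USet Q} (hx : x.IsSet) (q : Q) :
    x ≤ atom q ↔ x ≤ {atom q} := by
  rw [le_iff_of_isSet hx (isSet_singleton _)]
  induction x using USet.ind with | _ a => ?_
  cases a with
  | atom q => exact hx.elim
  | mk ι A =>
    constructor
    · intro h x' hx'
      obtain ⟨i, rfl⟩ := mem_mk.1 hx'
      exact ⟨atom q, by simp, h i⟩
    · intro h i
      obtain ⟨y', hy', h'⟩ := h _ (mem_mk.2 ⟨i, rfl⟩)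
      rw [mem_singleton] at hy'
      subst hy'
      exact h'

theorem atom_le_iff {y : USet Q} (hy : y.IsSet) (p : Q) :
    atom p ≤ y ↔ {atom p} ≤ y := by
  rw [le_iff_of_isSet (isSet_singleton _) hy]
  induction y using USet.ind with | _ b => ?_
  cases b with
  | atom q => exact hy.elim
  | mk κ B =>
    constructor
    · rintro ⟨j, hj⟩ x' hx'
      rw [mem_singleton] at hx'
      subst hx'
      exact ⟨_, mem_mk.2 ⟨j, rfl⟩, hj⟩
    · intro h
      obtain ⟨y', hy', h'⟩ := h (atom p) (by simp)
      obtain ⟨j, rfl⟩ := mem_mk.1 hy'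
      exact ⟨j, h'⟩

end LE

section Mul

variable [Mul Q]

@[simp] theorem atom_mul_atom (p q : Q) : atom p * atom q = atom (p * q) := rfl

theorem mem_mul_iff {x y : USet Q} (hx : x.IsSet) (hy : y.IsSet) {z : USet Q} :
    z ∈ x * y ↔ ∃ x' ∈ x, ∃ y' ∈ y, z = x' * y' := by
  induction x using USet.ind with | _ a => ?_
  induction y using USet.ind with | _ b => ?_
  cases a with
  | atom q => exact hx.elim
  | mk ι A =>
    cases b with
    | atom q => exact hy.elim
    | mk κ B =>
      refine mem_mk.trans ⟨?_, ?_⟩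
      · rintro ⟨⟨i, j⟩, rfl⟩
        exact ⟨_, mem_mk.2 ⟨i, rfl⟩, _, mem_mk.2 ⟨j, rfl⟩, rfl⟩
      · rintro ⟨x', hx', y', hy', rfl⟩
        obtain ⟨i, rfl⟩ := mem_mk.1 hx'
        obtain ⟨j, rfl⟩ := mem_mk.1 hy'
        exact ⟨(i, j), rfl⟩

theorem isSet_mul {x y : USet Q} (hx : x.IsSet) (hy : y.IsSet) : (x * y).IsSet := by
  induction x using USet.ind with | _ a => ?_
  induction y using USet.ind with | _ b => ?_
  cases a with
  | atom q => exact hx.elim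
  | mk ι A =>
    cases b with
    | atom q => exact hy.elim
    | mk κ B => trivial

theorem atom_mul {y : USet Q} (hy : y.IsSet) (p : Q) : atom p * y = {atom p} * y := by
  refine ext_of_isSet ?_ (isSet_mul (isSet_singleton _) hy) fun z => ?_
  · induction y using USet.ind with | _ b => ?_
    cases b with
    | atom q => exact hy.elim
    | mk κ B => trivial
  · rw [mem_mul_iff (isSet_singleton _) hy]
    induction y using USet.ind with | _ b => ?_
    cases b with
    | atom q => exact hy.elim
    | mk κ B =>
      refine mem_mk.trans ⟨?_, ?_⟩
      · rintro ⟨j, rfl⟩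
        exact ⟨atom p, by simp, _, mem_mk.2 ⟨j, rfl⟩, rfl⟩
      · rintro ⟨x', hx', y', hy', rfl⟩
        rw [mem_singleton] at hx'
        subst hx'
        obtain ⟨j, rfl⟩ := mem_mk.1 hy'
        exact ⟨j, rfl⟩

theorem mul_atom {x : USet Q} (hx : x.IsSet) (q : Q) : x * atom q = x * {atom q} := by
  refine ext_of_isSet ?_ (isSet_mul hx (isSet_singleton _)) fun z => ?_
  · induction x using USet.ind with | _ a => ?_
    cases a with
    | atom q => exact hx.elim
    | mk ι A => trivial
  · rw [mem_mul_iff hx (isSet_singleton _)]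
    induction x using USet.ind with | _ a => ?_
    cases a with
    | atom q => exact hx.elim
    | mk ι A =>
      refine mem_mk.trans ⟨?_, ?_⟩
      · rintro ⟨i, rfl⟩
        exact ⟨_, mem_mk.2 ⟨i, rfl⟩, atom q, by simp, rfl⟩
      · rintro ⟨x', hx', y', hy', rfl⟩
        rw [mem_singleton] at hy'
        subst hy'
        obtain ⟨i, rfl⟩ := mem_mk.1 hx'
        exact ⟨i, rfl⟩

end Mul

/-- `V̇_α(Q)`: the urelements, together with the sets of rank `< α` that have an urelement in
their transitive closure. -/
def VDot (Q : Type u) (α : Ordinal.{u}) : Set (USet Q) :=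
  {x | (∃ q, x = atom q) ∨
    (x.IsSet ∧ x.rank < α ∧ ∃ q : Q, Relation.TransGen (fun a b => a ∈ b) (atom q) x)}

/-- The nonempty `≲`-directed subsets `T` of `S`, as objects of the universe, such that `S \ T` is
the upward closure in `S` of a finite subset of `S`. -/
def IdealsF [LE Q] (S : Set (USet Q)) : Set (USet Q) :=
  {T | T.IsSet ∧ T.elems.Nonempty ∧
    (∃ A : Set (USet Q), A.Finite ∧ A ⊆ S ∧ T.elems = {z ∈ S | ∀ a ∈ A, ¬ a ≤ z}) ∧
    DirectedOn (· ≤ ·) T.elems}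

/-- The hierarchy `Î_α` of iterated ideals over a suborder `U` of the quasi-order `Q`:
`Î_α(U) = U ∪ ⋃_{β < α} IdealsF (Î_β(U))`. -/
def IHat [LE Q] (U : Set Q) (α : Ordinal.{u}) : Set (USet Q) :=
  atom '' U ∪ ⋃ β : Set.Iio α, IdealsF (IHat U β.1)
termination_by α
decreasing_by exact β.2

/-- The elements of `Î_γ(Q)` that are equivalent to the product `x · y`. -/
def mulCandidates [LE Q] [Mul Q] (x y : USet Q) (γ : Ordinal.{u}) : Set (USet Q) :=
  {z ∈ IHat (Set.univ : Set Q) γ | z.Equi (x * y)}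

open Classical in
/-- The product of `Î_α(Q)`: a chosen element equivalent to `x · y` from the first level of the
hierarchy that has one if that level is at most `α`, and `∅` if there is none. -/
noncomputable def hatMul [LE Q] [Mul Q] (α : Ordinal.{u}) (x y : USet Q) : USet Q :=
  if h : ∃ γ ≤ α, (∃ z, z ∈ mulCandidates x y γ) ∧ ∀ δ < γ, ¬ ∃ z, z ∈ mulCandidates x y δ then
    h.choose_spec.2.1.choose
  else ∅

/-- Finite products `x₀ · ⋯ · xₙ` with respect to the product of `Î_α(Q)`; the product of the empty
sequence is the neutral element of `Q`. -/
noncomputable def hatProd [LE Q] [Monoid Q] (α : Ordinal.{u}) : List (USet Q) → USet Q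
  | [] => atom 1
  | [x] => x
  | x :: y :: l => hatMul α x (hatProd α (y :: l))

/-- The primes of `Î_α(Q)`. -/
def Prim (Q : Type u) [LE Q] [Mul Q] (α : Ordinal.{u}) : Set (USet Q) :=
  {x ∈ IHat (Set.univ : Set Q) α |
    (∃ y ∈ IHat (Set.univ : Set Q) α, ¬ (hatMul α x y).Equi y) ∧
    ∀ y ∈ IHat (Set.univ : Set Q) α, ∀ z ∈ IHat (Set.univ : Set Q) α,
      x.Equi (hatMul α y z) → x.Equi y ∨ x.Equi z}

/-- `x` is a set closed under products up to `≲`. -/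
def MulClosed [LE Q] [Mul Q] (x : USet Q) : Prop :=
  x.IsSet ∧ ∀ y ∈ x, ∀ z ∈ x, ∃ w ∈ x, y * z ≤ w

end USet

/-! ### Multiplicative quasi-orders -/

/-- `op` makes `(S, le)` a multiplicative quasi-order. -/
structure IsMultiplicativeQo {X : Type*} (S : Set X) (le : X → X → Prop) (op : X → X → X) :
    Prop where
  op_mem : ∀ x ∈ S, ∀ y ∈ S, op x y ∈ S
  refl : ∀ x ∈ S, le x x
  trans : ∀ x ∈ S, ∀ y ∈ S, ∀ z ∈ S, le x y → le y z → le x z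
  assoc : ∀ x ∈ S, ∀ y ∈ S, ∀ z ∈ S,
    le (op (op x y) z) (op x (op y z)) ∧ le (op x (op y z)) (op (op x y) z)
  le_op : ∀ x ∈ S, ∀ y ∈ S, le x (op x y)
  mono : ∀ x ∈ S, ∀ x' ∈ S, ∀ y ∈ S, ∀ y' ∈ S, le x x' → le y y' → le (op x y) (op x' y')

/-- The `+`-property of `(S, le, op)`. -/
def HasPlusProperty {X : Type*} (S : Set X) (le : X → X → Prop) (op : X → X → X) : Prop :=
  ∀ a ∈ S, ∀ b ∈ S, ∀ c ∈ S, le c (op a b) →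
    ∃ a' ∈ S, ∃ b' ∈ S, le a' a ∧ le b' b ∧ le c (op a' b') ∧ le (op a' b') c

/-! ### Fronts, arrays and `ζ`-well quasi-orders -/

/-- `s` is an initial segment of `t`, both being listed in increasing order. -/
def InitSeg (s t : Set ℕ) : Prop := s ⊆ t ∧ ∀ m ∈ s, ∀ n ∈ t \ s, m < n

/-- For a family `F` of finite sets of natural numbers, the finite subsets of `⋃ F` that are proper
initial segments of members of `F`. -/
def frontTree (F : Set (Finset ℕ)) : Set (Finset ℕ) :=
  {σ | (∀ n ∈ σ, ∃ ρ ∈ F, n ∈ ρ) ∧ ∃ τ ∈ F, InitSeg (σ : Set ℕ) τ ∧ σ ≠ τ}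

/-- A front, equipped with a rank. -/
structure RankedFront where
  carrier : Set (Finset ℕ)
  infinite : carrier.Infinite
  antichain : ∀ σ ∈ carrier, ∀ τ ∈ carrier, InitSeg (σ : Set ℕ) τ → σ = τ
  covers : ∀ X : Set ℕ, X.Infinite → (∀ n ∈ X, ∃ ρ ∈ carrier, n ∈ ρ) →
    ∃ σ ∈ carrier, InitSeg (σ : Set ℕ) X
  rk : frontTree carrier → Ordinal.{u}
  rk_lt : ∀ σ τ : frontTree carrier, InitSeg (σ.1 : Set ℕ) τ.1 → σ ≠ τ → rk τ < rk σ

/-- The relation `σ ◁ τ` between nonempty finite sets of natural numbers. -/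
def ShiftRel (σ τ : Finset ℕ) : Prop :=
  ∃ (hσ : σ.Nonempty) (hτ : τ.Nonempty), σ.min' hσ < τ.min' hτ ∧
    (InitSeg (σ.erase (σ.min' hσ) : Set ℕ) τ ∨ InitSeg (τ : Set ℕ) (σ.erase (σ.min' hσ)))

/-- The array `f` on a front is bad. -/
def BadArray {P : Type*} [LE P] (F : RankedFront.{u}) (f : F.carrier → P) : Prop :=
  ∀ σ τ : F.carrier, ShiftRel σ.1 τ.1 → ¬ f σ ≤ f τ

/-- `F` has rank `< ζ`, i.e. the empty sequence has rank `< ζ`. -/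
def RankedFront.RankLT (F : RankedFront.{u}) (ζ : Ordinal.{u}) : Prop :=
  ∃ h : ∅ ∈ frontTree F.carrier, F.rk ⟨∅, h⟩ < ζ

/-- `P` is a `ζ`-well quasi-order: it is well-founded and there are no bad arrays of rank `< ζ`
with values in `P`. -/
def IsOrdWqo (ζ : Ordinal.{u}) (P : Type*) [Preorder P] : Prop :=
  WellFounded (fun a b : P => a < b) ∧
    ∀ F : RankedFront.{u}, F.RankLT ζ → ∀ f : F.carrier → P, ¬ BadArray F f

/-! ### Finite sequences over `P` and the maps `f_α` -/

/-- The embeddability order on the finite sequences `P^{<ω}`: `u ≤ v` iff `u` is pointwise below a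
subsequence of `v`. The product of `FreeMonoid P` is concatenation. -/
instance wordPreorder (P : Type u) [Preorder P] : Preorder (FreeMonoid P) where
  le u v := List.SublistForall₂ (· ≤ ·) u.toList v.toList
  le_refl u := Std.Refl.refl (r := List.SublistForall₂ (fun a b : P => a ≤ b)) u.toList
  le_trans u v w h h' := IsTrans.trans (r := List.SublistForall₂ (fun a b : P => a ≤ b))
    u.toList v.toList w.toList h h'

section FMap

variable (P : Type u) [Preorder P]

/-- The domain `⋃_{β ≤ α} Prim (Î_β(P^{<ω}))` of the map `f_α`. -/
def fDom (α : Ordinal.{u}) : Set (USet (FreeMonoid P)) :=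
  {x | ∃ β ≤ α, x ∈ USet.Prim (FreeMonoid P) β}

variable {P}

/-- `{ g x' : x' ∈ x ∩ D, g x' ≠ ⊥ }` for a map `g` with values in `V(P ⊔ {⋆}) ⊔ {⊥}`. -/
def imageSet (D : Set (USet (FreeMonoid P)))
    (g : USet (FreeMonoid P) → Option (USet (P ⊕ Unit))) (x : USet (FreeMonoid P)) :
    Set (USet (P ⊕ Unit)) :=
  {v | ∃ x' ∈ x.elems ∩ D, g x' = some v}

instance small_imageSet (D : Set (USet (FreeMonoid P)))
    (g : USet (FreeMonoid P) → Option (USet (P ⊕ Unit))) (x : USet (FreeMonoid P)) :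
    Small.{u} (imageSet D g x) := by
  have h : imageSet D g x ⊆ (fun x' => (g x').getD ∅) '' x.elems := by
    rintro v ⟨x', ⟨hx', -⟩, h⟩
    exact ⟨x', hx', by simp [h]⟩
  exact small_subset h

variable (P)

open Classical in
/-- The recursively defined maps `f_α`. The value `none` is `⊥` ("undefined"), and `f_α x` is only
meaningful for `x ∈ fDom P α`. The element `⋆` of `P ⊔ {⋆}` is `Sum.inr ()`. -/
noncomputable def fMap (α : Ordinal.{u}) :
    USet (FreeMonoid P) → Option (USet (P ⊕ Unit)) :=
  Ordinal.limitRecOn α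
    (fun x =>
      if h : ∃ p : P, x = USet.atom (FreeMonoid.of p) then
        some (USet.atom (Sum.inl h.choose))
      else none)
    (fun α fα x =>
      if x ∈ fDom P α then fα x
      else if (∃ y ∈ USet.IHat (Set.range (FreeMonoid.of : P → FreeMonoid P)) (α + 1), y.Equi x) ∧
          ∀ x' ∈ x.elems ∩ fDom P α, fα x' ≠ none then
        some (USet.ofSet (imageSet (fDom P α) fα x))
      else if (∀ x' ∈ x.elems ∩ fDom P α, fα x' ≠ none) ∧
          ∃ y ∈ USet.IdealsF (USet.IHat (Set.univ : Set (FreeMonoid P)) α),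
            y.MulClosed ∧ y.Equi x then
        some (USet.ofSet (insert (USet.atom (Sum.inr ())) (imageSet (fDom P α) fα x)))
      else none)
    (fun l _ f x =>
      if h : ∃ β, ∃ _ : β < l, x ∈ fDom P β then f h.choose h.choose_spec.choose x else none)

/-- The maps `f_α` extend each other, so that at limits `f_λ` is the union of the earlier maps. -/
theorem fMap_eq_of_mem_fDom {α β : Ordinal.{u}} (h : β ≤ α) {x : USet (FreeMonoid P)}
    (hx : x ∈ fDom P β) : fMap P α x = fMap P β x := by
  induction α using Ordinal.limitRecOn generalizing β with
  | zero => rw [nonpos_iff_eq_zero.1 h]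
  | add_one α ih =>
    rcases h.eq_or_lt with rfl | h
    · rfl
    · have hβ : β ≤ α := Order.lt_add_one_iff.1 h
      rw [← ih hβ hx]
      have hxα : x ∈ fDom P α := by
        obtain ⟨γ, hγ, h'⟩ := hx
        exact ⟨γ, hγ.trans hβ, h'⟩
      unfold fMap
      rw [Ordinal.limitRecOn_add_one]
      exact if_pos hxα
  | limit l hl ih =>
    rcases h.eq_or_lt with rfl | h
    · rfl
    · have hex : ∃ γ, ∃ _ : γ < l, x ∈ fDom P γ := ⟨β, h, hx⟩
      have e : fMap P l x = fMap P hex.choose x := by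
        conv_lhs => unfold fMap
        rw [Ordinal.limitRecOn_limit _ _ _ _ hl, dif_pos hex]
        rfl
      rw [e]
      have h₁ := hex.choose_spec.choose
      have h₂ := hex.choose_spec.choose_spec
      rcases le_total β hex.choose with h' | h'
      · exact ih _ h₁ h' hx
      · exact (ih _ h h' h₂).symm

end FMap

/-! The core is that each level `WHat P α` with α < ζ is a well quasi-order (`isPWO_WHat`), by
induction on α. Clauses 1–4 at α need this only for the levels below α; clause 5 uses it at α as
well.

Assume it below α. In a well quasi-order every downward closed set has a complement generated by
finitely many elements, so all nonempty directed downward closed sets are ideals in the required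
sense, and downward closed sets satisfy the descending chain condition. Hence products of ideals are
equivalent to ideals (`exists_equi_mul`). An ideal covered by the products of two downward closed
sets is equivalent to a product of two ideals inside them (`exists_equi_mul_of_cover`), which yields
the +-property (`splits_IHat`). Well-foundedness gives factorizations into primes
(`exists_prim_factors`).

The decisive fact is `thin_or_mul_le`: a prime x is either thin (no two-letter word lies below it),
and then it comes from the hierarchy over the letters, or it satisfies x · x ≲ x. So the recursion
for f_α never reaches ⊥, and ⋆ marks the second kind. An element of a thin ideal is a product of at
most one of its primes; an ideal of the second kind contains all products of its primes up to ≲. In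
both cases comparing primes is enough, so f_α reflects the order (`le_of_fMap_le`).

To close the induction, the Nash-Williams partition theorem (`exists_homogeneous`) shows that the
isolated point ⋆ creates no bad arrays. A bad sequence in `VDot (P ⊕ Unit) α` would unravel into a
bad array on a front of rank α < ζ (`isPWO_VDot`). Order reflection carries the well quasi-order
back to the domain of f_α, and Higman's lemma carries it to finite products of elements of that
domain, which exhaust level α up to equivalence (`exists_fDom_factors`). -/

namespace USet

/-! ### Induction on membership, with urelements as their own elements. -/

section Basic

variable {Q : Type u}

theorem isSet_or_atom (x : USet Q) : x.IsSet ∨ ∃ q, x = atom q := by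
  by_cases h : x.IsSet
  · exact .inl h
  · rw [isSet_iff] at h
    push Not at h
    exact .inr h

/-- The elements of a set; an urelement is regarded as its own only element. -/
def els (x : USet Q) : Set (USet Q) := {z | z ∈ x ∨ (¬ x.IsSet ∧ z = x)}

@[simp] theorem els_atom (q : Q) : els (atom q) = {atom q} := by
  ext z; simp [els]

theorem mem_els {x z : USet Q} (hx : x.IsSet) : z ∈ els x ↔ z ∈ x := by
  simp [els, hx]

theorem els_eq {x : USet Q} (hx : x.IsSet) : els x = x.elems := by
  ext z; exact mem_els hx

theorem ext_els {x y : USet Q} (hx : x.IsSet) (hy : y.IsSet) (h : ∀ z, z ∈ els x ↔ z ∈ els y) :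
    x = y :=
  ext_of_isSet hx hy fun z => by rw [← mem_els hx, ← mem_els hy, h]

theorem mem_wf : WellFounded (fun a b : USet Q => a ∈ b) := by
  refine ⟨fun x => ?_⟩
  induction x using USet.ind with | _ a => ?_
  induction a with
  | atom q => exact ⟨_, fun y hy => (notMem_atom y q hy).elim⟩
  | mk ι A ih =>
    refine ⟨_, fun y hy => ?_⟩
    obtain ⟨i, rfl⟩ := mem_mk.1 hy
    exact ih i

theorem mem_induction {p : USet Q → Prop} (h : ∀ x, (∀ y ∈ x, p y) → p x) (x : USet Q) : p x :=
  mem_wf.induction x h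

instance : IsWellFounded (USet Q) (fun a b => a ∈ b) := ⟨mem_wf⟩

/-- The rank with respect to the membership relation. -/
noncomputable def depth (x : USet Q) : Ordinal.{u + 1} :=
  IsWellFounded.rank (fun a b : USet Q => a ∈ b) x

theorem depth_lt {x y : USet Q} (h : x ∈ y) : x.depth < y.depth :=
  IsWellFounded.rank_lt_of_rel (r := fun a b : USet Q => a ∈ b) h

@[simp] theorem depth_atom (q : Q) : (atom q).depth = 0 := by
  unfold depth
  rw [IsWellFounded.rank_eq]
  have : IsEmpty { b : USet Q // b ∈ atom q } := ⟨fun b => notMem_atom _ _ b.2⟩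
  simp

/-- When `x` is an urelement its depth 0 cannot drop; the bound then comes from `y`, whose depth is
positive because it contains `y'`. -/
theorem depth_els_lt {x x' y y' : USet Q} (hx : x' ∈ els x) (hy : y' ∈ els y) (h : y.IsSet) :
    x'.depth < max x.depth y.depth := by
  rcases isSet_or_atom x with hs | ⟨q, rfl⟩
  · exact lt_max_of_lt_left (depth_lt ((mem_els hs).1 hx))
  · rw [els_atom, Set.mem_singleton_iff] at hx
    subst hx
    refine lt_max_of_lt_right (lt_of_le_of_lt ?_ (depth_lt ((mem_els h).1 hy)))
    simp

/-- Three objects descend to elements simultaneously, urelements staying fixed. The maximum of the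
depths drops as soon as one of the three is a set. -/
theorem ind₃ {p : USet Q → USet Q → USet Q → Prop}
    (h : ∀ x y z, (x.IsSet ∨ y.IsSet ∨ z.IsSet →
      ∀ x' ∈ els x, ∀ y' ∈ els y, ∀ z' ∈ els z, p x' y' z') → p x y z) (x y z : USet Q) :
    p x y z := by
  induction e : max x.depth (max y.depth z.depth) using WellFoundedLT.induction
    generalizing x y z with
  | _ o ih =>
    subst e
    refine h x y z fun hs x' hx y' hy z' hz => ih _ ?_ x' y' z' rfl
    have key : ∀ {a a' b b' : USet Q}, a' ∈ els a → b' ∈ els b → b.IsSet →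
        b.depth ≤ max x.depth (max y.depth z.depth) →
        a.depth ≤ max x.depth (max y.depth z.depth) →
        a'.depth < max x.depth (max y.depth z.depth) := fun ha hb hs h₁ h₂ =>
      (depth_els_lt ha hb hs).trans_le (max_le h₂ h₁)
    have k₁ : x.depth ≤ max x.depth (max y.depth z.depth) := le_max_left _ _
    have k₂ : y.depth ≤ max x.depth (max y.depth z.depth) :=
      (le_max_left _ _).trans (le_max_right _ _)
    have k₃ : z.depth ≤ max x.depth (max y.depth z.depth) :=
      (le_max_right _ _).trans (le_max_right _ _)
    rcases hs with hs | hs | hs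
    · exact max_lt (key hx hx hs k₁ k₁) (max_lt (key hy hx hs k₁ k₂) (key hz hx hs k₁ k₃))
    · exact max_lt (key hx hy hs k₂ k₁) (max_lt (key hy hy hs k₂ k₂) (key hz hy hs k₂ k₃))
    · exact max_lt (key hx hz hs k₃ k₁) (max_lt (key hy hz hs k₃ k₂) (key hz hz hs k₃ k₃))

end Basic

/-! ### The quasi-order and the product on the universe. -/

section Order

variable {Q : Type u}

/-- With `els` the singleton convention disappears and one clause covers all cases. Between two
urelements the clause is circular, so inductions that use it treat that case separately. -/
theorem le_iff [LE Q] {x y : USet Q} : x ≤ y ↔ ∀ x' ∈ els x, ∃ y' ∈ els y, x' ≤ y' := by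
  rcases isSet_or_atom x with hx | ⟨p, rfl⟩ <;> rcases isSet_or_atom y with hy | ⟨q, rfl⟩
  · simpa [els_eq hx, els_eq hy, elems] using le_iff_of_isSet hx hy
  · rw [le_atom_iff hx, le_iff_of_isSet hx (isSet_singleton _)]
    simp [els_eq hx, elems]
  · rw [atom_le_iff hy, le_iff_of_isSet (isSet_singleton _) hy]
    simp [els_eq hy, elems]
  · simp

variable [Preorder Q]

theorem le_refl' (x : USet Q) : x ≤ x := by
  induction x using mem_induction with
  | _ x ih =>
    rcases isSet_or_atom x with hx | ⟨p, rfl⟩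
    · exact le_iff.2 fun x' hx' => ⟨x', hx', ih x' ((mem_els hx).1 hx')⟩
    · exact atom_le_atom.2 le_rfl

theorem le_trans' (x y z : USet Q) : x ≤ y → y ≤ z → x ≤ z := by
  induction x, y, z using ind₃ with
  | _ x y z ih =>
    intro h₁ h₂
    by_cases hs : x.IsSet ∨ y.IsSet ∨ z.IsSet
    · refine le_iff.2 fun x' hx => ?_
      obtain ⟨y', hy, h₁'⟩ := le_iff.1 h₁ x' hx
      obtain ⟨z', hz, h₂'⟩ := le_iff.1 h₂ y' hy
      exact ⟨z', hz, ih hs x' hx y' hy z' hz h₁' h₂'⟩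
    · push Not at hs
      obtain ⟨p, rfl⟩ := (isSet_or_atom x).resolve_left hs.1
      obtain ⟨q, rfl⟩ := (isSet_or_atom y).resolve_left hs.2.1
      obtain ⟨r, rfl⟩ := (isSet_or_atom z).resolve_left hs.2.2
      exact atom_le_atom.2 ((atom_le_atom.1 h₁).trans (atom_le_atom.1 h₂))

instance : Preorder (USet Q) where
  toLE := inferInstance
  le_refl := le_refl'
  le_trans := le_trans'

theorem atom_le {p : Q} {y : USet Q} : atom p ≤ y ↔ ∃ y' ∈ els y, atom p ≤ y' := by
  rw [le_iff]; simp

theorem le_atom {x : USet Q} {q : Q} : x ≤ atom q ↔ ∀ x' ∈ els x, x' ≤ atom q := by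
  rw [le_iff]; simp

theorem Equi.symm {x y : USet Q} (h : x.Equi y) : y.Equi x := ⟨h.2, h.1⟩

theorem Equi.refl (x : USet Q) : x.Equi x := ⟨le_rfl, le_rfl⟩

theorem Equi.trans {x y z : USet Q} (h : x.Equi y) (h' : y.Equi z) : x.Equi z :=
  ⟨h.1.trans h'.1, h'.2.trans h.2⟩

end Order

section Mul

variable {Q : Type u} [Mul Q]

theorem isSet_mul_iff {x y : USet Q} : (x * y).IsSet ↔ x.IsSet ∨ y.IsSet := by
  rcases isSet_or_atom x with hx | ⟨p, rfl⟩ <;> rcases isSet_or_atom y with hy | ⟨q, rfl⟩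
  · simp [isSet_mul, hx, hy]
  · simp [mul_atom hx, isSet_mul, hx]
  · simp [atom_mul hy, isSet_mul, hy]
  · simp

theorem mem_els_mul {x y z : USet Q} :
    z ∈ els (x * y) ↔ ∃ x' ∈ els x, ∃ y' ∈ els y, z = x' * y' := by
  by_cases h : (x * y).IsSet
  · rw [mem_els h]
    rcases isSet_or_atom x with hx | ⟨p, rfl⟩ <;> rcases isSet_or_atom y with hy | ⟨q, rfl⟩
    · simp [mem_mul_iff hx hy, mem_els hx, mem_els hy]
    · rw [mul_atom hx, mem_mul_iff hx (isSet_singleton _)]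
      simp [mem_els hx]
    · rw [atom_mul hy, mem_mul_iff (isSet_singleton _) hy]
      simp [mem_els hy]
    · simp at h
  · rw [isSet_mul_iff] at h
    push Not at h
    obtain ⟨p, rfl⟩ := (isSet_or_atom x).resolve_left h.1
    obtain ⟨q, rfl⟩ := (isSet_or_atom y).resolve_left h.2
    simp

theorem mul_mem_els {x y x' y' : USet Q} (hx : x' ∈ els x) (hy : y' ∈ els y) :
    x' * y' ∈ els (x * y) :=
  mem_els_mul.2 ⟨x', hx, y', hy, rfl⟩

end Mul

section Monoid

variable {Q : Type u} [Monoid Q]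

theorem mul_assoc' (x y z : USet Q) : x * y * z = x * (y * z) := by
  induction x, y, z using ind₃ with
  | _ x y z ih =>
    by_cases hs : x.IsSet ∨ y.IsSet ∨ z.IsSet
    · refine ext_els (by simpa [isSet_mul_iff, or_assoc] using hs)
        (by simpa [isSet_mul_iff] using hs) fun w => ?_
      constructor
      · intro hw
        obtain ⟨v, hv, z', hz, rfl⟩ := mem_els_mul.1 hw
        obtain ⟨x', hx, y', hy, rfl⟩ := mem_els_mul.1 hv
        rw [ih hs x' hx y' hy z' hz]
        exact mul_mem_els hx (mul_mem_els hy hz)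
      · intro hw
        obtain ⟨x', hx, v, hv, rfl⟩ := mem_els_mul.1 hw
        obtain ⟨y', hy, z', hz, rfl⟩ := mem_els_mul.1 hv
        rw [← ih hs x' hx y' hy z' hz]
        exact mul_mem_els (mul_mem_els hx hy) hz
    · push Not at hs
      obtain ⟨p, rfl⟩ := (isSet_or_atom x).resolve_left hs.1
      obtain ⟨q, rfl⟩ := (isSet_or_atom y).resolve_left hs.2.1
      obtain ⟨r, rfl⟩ := (isSet_or_atom z).resolve_left hs.2.2
      simp [mul_assoc]

theorem mul_atom_one (x : USet Q) : x * atom 1 = x := by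
  induction x using mem_induction with
  | _ x ih =>
    rcases isSet_or_atom x with hx | ⟨p, rfl⟩
    · refine ext_els (by simp [isSet_mul_iff, hx]) hx fun w => ?_
      simp only [mem_els_mul, els_atom, Set.mem_singleton_iff, exists_eq_left]
      constructor
      · rintro ⟨x', hx', rfl⟩
        rwa [ih x' ((mem_els hx).1 hx')]
      · exact fun hw => ⟨w, hw, (ih w ((mem_els hx).1 hw)).symm⟩
    · simp

theorem atom_one_mul (x : USet Q) : atom 1 * x = x := by
  induction x using mem_induction with
  | _ x ih =>
    rcases isSet_or_atom x with hx | ⟨p, rfl⟩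
    · refine ext_els (by simp [isSet_mul_iff, hx]) hx fun w => ?_
      simp only [mem_els_mul, els_atom, Set.mem_singleton_iff, exists_eq_left]
      constructor
      · rintro ⟨x', hx', rfl⟩
        rwa [ih x' ((mem_els hx).1 hx')]
      · exact fun hw => ⟨w, hw, (ih w ((mem_els hx).1 hw)).symm⟩
    · simp

noncomputable instance : Monoid (USet Q) where
  one := atom 1
  mul_assoc := mul_assoc'
  one_mul := atom_one_mul
  mul_one := mul_atom_one

theorem one_def : (1 : USet Q) = atom 1 := rfl

theorem mul_mono_right [Preorder Q] [MulLeftMono Q] (x y y' : USet Q) :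
    y ≤ y' → x * y ≤ x * y' := by
  induction x, y, y' using ind₃ with
  | _ x y y' ih =>
    intro h
    by_cases hs : x.IsSet ∨ y.IsSet ∨ y'.IsSet
    · refine le_iff.2 fun w hw => ?_
      obtain ⟨a, ha, b, hb, rfl⟩ := mem_els_mul.1 hw
      obtain ⟨b', hb', h'⟩ := le_iff.1 h b hb
      exact ⟨a * b', mul_mem_els ha hb', ih hs a ha b hb b' hb' h'⟩
    · push Not at hs
      obtain ⟨p, rfl⟩ := (isSet_or_atom x).resolve_left hs.1
      obtain ⟨q, rfl⟩ := (isSet_or_atom y).resolve_left hs.2.1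
      obtain ⟨r, rfl⟩ := (isSet_or_atom y').resolve_left hs.2.2
      exact atom_le_atom.2 (mul_le_mul_right (atom_le_atom.1 h) _)

theorem mul_mono_left [Preorder Q] [MulRightMono Q] (x y y' : USet Q) :
    y ≤ y' → y * x ≤ y' * x := by
  induction x, y, y' using ind₃ with
  | _ x y y' ih =>
    intro h
    by_cases hs : x.IsSet ∨ y.IsSet ∨ y'.IsSet
    · refine le_iff.2 fun w hw => ?_
      obtain ⟨b, hb, a, ha, rfl⟩ := mem_els_mul.1 hw
      obtain ⟨b', hb', h'⟩ := le_iff.1 h b hb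
      exact ⟨b' * a, mul_mem_els hb' ha, ih hs a ha b hb b' hb' h'⟩
    · push Not at hs
      obtain ⟨p, rfl⟩ := (isSet_or_atom x).resolve_left hs.1
      obtain ⟨q, rfl⟩ := (isSet_or_atom y).resolve_left hs.2.1
      obtain ⟨r, rfl⟩ := (isSet_or_atom y').resolve_left hs.2.2
      exact atom_le_atom.2 (mul_le_mul_left (atom_le_atom.1 h) _)

instance [Preorder Q] [MulLeftMono Q] : MulLeftMono (USet Q) := ⟨fun _ _ _ => mul_mono_right _ _ _⟩

instance [Preorder Q] [MulRightMono Q] : MulRightMono (USet Q) := ⟨fun _ _ _ => mul_mono_left _ _ _⟩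

end Monoid

end USet

/-! ### Finite sequences under embeddability. -/

section Words

variable {P : Type u} [Preorder P]

theorem word_le_iff {v w : FreeMonoid P} :
    v ≤ w ↔ List.SublistForall₂ (· ≤ ·) v.toList w.toList := Iff.rfl

theorem one_le_word (w : FreeMonoid P) : 1 ≤ w := List.SublistForall₂.nil

theorem length_le_of_word_le {v w : FreeMonoid P} (h : v ≤ w) :
    v.toList.length ≤ w.toList.length := by
  obtain ⟨l, h₁, h₂⟩ := List.sublistForall₂_iff.1 (word_le_iff.1 h)
  exact h₁.length_eq.trans_le h₂.length_le

theorem word_mul_le_mul {v v' w w' : FreeMonoid P} (h : v ≤ v') (h' : w ≤ w') :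
    v * w ≤ v' * w' := by
  obtain ⟨l, h₁, h₂⟩ := List.sublistForall₂_iff.1 (word_le_iff.1 h)
  obtain ⟨l', h₁', h₂'⟩ := List.sublistForall₂_iff.1 (word_le_iff.1 h')
  exact List.sublistForall₂_iff.2 ⟨l ++ l', List.rel_append h₁ h₁', h₂.append h₂'⟩

instance : MulLeftMono (FreeMonoid P) := ⟨fun _ _ _ h => word_mul_le_mul le_rfl h⟩

instance : MulRightMono (FreeMonoid P) := ⟨fun _ _ _ h => word_mul_le_mul h le_rfl⟩

/-- An embedding into `v * w` cuts `u` after the last letter sent into `v`. This is the base case of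
the +-property. -/
theorem exists_mul_of_le_mul {u v w : FreeMonoid P} (h : u ≤ v * w) :
    ∃ a b, u = a * b ∧ a ≤ v ∧ b ≤ w := by
  obtain ⟨l, h₁, h₂⟩ := List.sublistForall₂_iff.1 (word_le_iff.1 h)
  obtain ⟨l₁, l₂, rfl, h₃, h₄⟩ := List.sublist_append_iff.1
    (show l.Sublist (v.toList ++ w.toList) from h₂)
  refine ⟨FreeMonoid.ofList (u.toList.take l₁.length), FreeMonoid.ofList (u.toList.drop l₁.length),
    ?_, ?_, ?_⟩
  · exact (List.take_append_drop l₁.length u.toList).symm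
  · exact List.sublistForall₂_iff.2 ⟨l₁, List.forall₂_take_append _ _ _ h₁, h₃⟩
  · exact List.sublistForall₂_iff.2 ⟨l₂, List.forall₂_drop_append _ _ _ h₁, h₄⟩

theorem word_le_of {w : FreeMonoid P} {p : P} :
    FreeMonoid.of p ≤ w ↔ ∃ q ∈ w.toList, p ≤ q := by
  rw [word_le_iff]
  change List.SublistForall₂ (· ≤ ·) [p] _ ↔ _
  generalize w.toList = l
  induction l with
  | nil => exact iff_of_false nofun (by simp)
  | cons a l ih =>
    constructor
    · rintro (_ | ⟨h, _⟩ | h)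
      · exact ⟨a, by simp, h⟩
      · obtain ⟨q, hq, h⟩ := ih.1 h
        exact ⟨q, by simp [hq], h⟩
    · rintro ⟨q, hq, h⟩
      rcases List.mem_cons.1 hq with rfl | hq
      · exact .cons h .nil
      · exact .cons_right (ih.2 ⟨q, hq, h⟩)

theorem of_le_of {p q : P} : FreeMonoid.of p ≤ FreeMonoid.of q ↔ p ≤ q := by
  simp [word_le_of]

end Words

/-! ### Ideals and downward closed sets of a well quasi-order; products and the +-property in the
hierarchy. -/

namespace USet

section Hierarchy

variable {Q : Type u} [Preorder Q]

theorem mem_IHat {U : Set Q} {α : Ordinal.{u}} {x : USet Q} :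
    x ∈ IHat U α ↔ (∃ q ∈ U, atom q = x) ∨ ∃ β < α, x ∈ IdealsF (IHat U β) := by
  rw [IHat]; simp

theorem atom_mem_IHat {U : Set Q} {α : Ordinal.{u}} {q : Q} (h : q ∈ U) : atom q ∈ IHat U α :=
  mem_IHat.2 (.inl ⟨q, h, rfl⟩)

theorem mem_IHat_of_idealsF {U : Set Q} {α β : Ordinal.{u}} {x : USet Q} (h : β < α)
    (hx : x ∈ IdealsF (IHat U β)) : x ∈ IHat U α :=
  mem_IHat.2 (.inr ⟨β, h, hx⟩)

theorem IHat_mono {U : Set Q} {α β : Ordinal.{u}} (h : α ≤ β) : IHat U α ⊆ IHat U β := by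
  intro x hx
  rcases mem_IHat.1 hx with ⟨q, hq, rfl⟩ | ⟨γ, hγ, hx⟩
  · exact atom_mem_IHat hq
  · exact mem_IHat_of_idealsF (hγ.trans_le h) hx

theorem isSet_of_idealsF {S : Set (USet Q)} {x : USet Q} (h : x ∈ IdealsF S) : x.IsSet := h.1

theorem subset_of_idealsF {S : Set (USet Q)} {x : USet Q} (h : x ∈ IdealsF S) : x.elems ⊆ S := by
  obtain ⟨-, -, ⟨A, -, -, hA⟩, -⟩ := h
  rw [hA]
  exact fun z hz => hz.1

/-- `D` is a downward closed subset of `S`. -/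
def IsDown (S D : Set (USet Q)) : Prop := D ⊆ S ∧ ∀ d ∈ D, ∀ z ∈ S, z ≤ d → z ∈ D

theorem isDown_of_idealsF {S : Set (USet Q)} {x : USet Q} (h : x ∈ IdealsF S) :
    IsDown S x.elems := by
  obtain ⟨-, -, ⟨A, -, -, hA⟩, -⟩ := h
  rw [hA]
  exact ⟨fun z hz => hz.1, fun d hd z hz hzd => ⟨hz, fun a ha h => hd.2 a ha (h.trans hzd)⟩⟩

theorem IsDown.sep {S D : Set (USet Q)} (h : IsDown S D) (a : USet Q) :
    IsDown S {z ∈ D | ¬ a ≤ z} :=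
  ⟨fun _ hz => h.1 hz.1, fun d hd z hz hzd => ⟨h.2 d hd.1 z hz hzd, fun h' => hd.2 (h'.trans hzd)⟩⟩

theorem sep_ssubset {A : Set (USet Q)} {a : USet Q} (ha : a ∈ A) : {z ∈ A | ¬ a ≤ z} ⊂ A :=
  ⟨fun _ hz => hz.1, fun h => (h ha).2 le_rfl⟩

/-- Ideals of `S` inject into the subsets of `S`. Smallness of the levels is what allows `ofSet` to
turn their subsets into objects. -/
instance small_idealsF (S : Set (USet Q)) [Small.{u} S] : Small.{u} (IdealsF S) := by
  let f : IdealsF S → Set S := fun x => {z | z.1 ∈ x.1}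
  refine small_of_injective (f := f) fun x y h => Subtype.ext ?_
  refine ext_of_isSet x.2.1 y.2.1 fun z => ?_
  have key : ∀ x y : IdealsF S, f x = f y → z ∈ x.1 → z ∈ y.1 := fun x y h hz => by
    have h' : (⟨z, subset_of_idealsF x.2 hz⟩ : S) ∈ f x := hz
    rw [h] at h'
    exact h'
  exact ⟨key x y h, key y x h.symm⟩

instance small_IHat (U : Set Q) (α : Ordinal.{u}) : Small.{u} (IHat U α) := by
  induction α using WellFoundedLT.induction with
  | _ α ih =>
    rw [IHat]
    have : ∀ β : Set.Iio α, Small.{u} (IdealsF (IHat U β.1)) := fun β => by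
      have := ih β.1 β.2
      infer_instance
    have : Small.{u} (⋃ β : Set.Iio α, IdealsF (IHat U β.1)) := small_iUnion _
    exact small_union _ _

theorem exists_le_of_isPWO {S : Set (USet Q)} (hS : S.IsPWO) (f : ℕ → USet Q)
    (hf : ∀ n, f n ∈ S) : ∃ m n, m < n ∧ f m ≤ f n := by
  obtain ⟨m, n, h, h'⟩ := hS fun n => ⟨f n, hf n⟩
  exact ⟨m, n, h, h'⟩

/-- If finitely many elements never generate `S \ D` upwards, one can keep choosing elements of `S \
D` that are above no earlier choice, which is a bad sequence in `S`. -/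
theorem exists_finite_basis {S D : Set (USet Q)} (hS : S.IsPWO) (hD : IsDown S D) :
    ∃ A : Set (USet Q), A.Finite ∧ A ⊆ S ∧ D = {z ∈ S | ∀ a ∈ A, ¬ a ≤ z} := by
  by_cases h : ∃ s : Finset (USet Q), (∀ x ∈ s, x ∈ S \ D) ∧ ∀ y ∈ S \ D, ∃ x ∈ s, x ≤ y
  · obtain ⟨s, hs, h⟩ := h
    refine ⟨s, s.finite_toSet, fun x hx => (hs x hx).1, Set.ext fun z => ⟨fun hz => ?_, ?_⟩⟩
    · exact ⟨hD.1 hz, fun a ha haz => (hs a ha).2 (hD.2 z hz a (hs a ha).1 haz)⟩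
    · rintro ⟨hz, hz'⟩
      by_contra hzD
      obtain ⟨x, hx, hxz⟩ := h z ⟨hz, hzD⟩
      exact hz' x hx hxz
  · push Not at h
    obtain ⟨f, hf, hf'⟩ := exists_seq_of_forall_finset_exists (fun x => x ∈ S \ D)
      (fun x y => ¬ x ≤ y) h
    obtain ⟨m, n, hmn, hle⟩ := exists_le_of_isPWO hS f fun n => (hf n).1
    exact (hf' m n hmn hle).elim

/-- Over a well quasi-order the finite set `A` in `IdealsF` comes for free, so building an ideal
only requires a nonempty directed downward closed set. -/
theorem exists_idealsF {S D : Set (USet Q)} [Small.{u} S] (hS : S.IsPWO) (hD : IsDown S D)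
    (hne : D.Nonempty) (hdir : DirectedOn (· ≤ ·) D) : ∃ x ∈ IdealsF S, x.elems = D := by
  have : Small.{u} D := small_subset hD.1
  have e : (ofSet D).elems = D := Set.ext fun z => mem_ofSet
  refine ⟨ofSet D, ⟨isSet_ofSet _, ?_, ?_, ?_⟩, e⟩
  · rwa [e]
  · rw [e]; exact exists_finite_basis hS hD
  · rwa [e]

/-- A directed set `C`, all of whose elements are equivalent to elements of `S`, generates an ideal
of `S`. -/
theorem exists_idealsF_of_directed {S C : Set (USet Q)} [Small.{u} S] (hS : S.IsPWO)
    (hne : C.Nonempty) (hdir : DirectedOn (· ≤ ·) C) (hC : ∀ c ∈ C, ∃ s ∈ S, s.Equi c) :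
    ∃ x ∈ IdealsF S, x.elems = {z ∈ S | ∃ c ∈ C, z ≤ c} ∧ ∀ c ∈ C, ∃ z ∈ x, c ≤ z := by
  obtain ⟨x, hx, e⟩ := exists_idealsF (D := {z ∈ S | ∃ c ∈ C, z ≤ c}) hS
    ⟨fun z hz => hz.1, fun d ⟨_, c, hc, hd⟩ z hz hzd => ⟨hz, c, hc, hzd.trans hd⟩⟩
    (by
      obtain ⟨c, hc⟩ := hne
      obtain ⟨s, hs, h⟩ := hC c hc
      exact ⟨s, hs, c, hc, h.1⟩)
    (by
      rintro z₁ ⟨-, c₁, hc₁, h₁⟩ z₂ ⟨-, c₂, hc₂, h₂⟩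
      obtain ⟨c, hc, k₁, k₂⟩ := hdir c₁ hc₁ c₂ hc₂
      obtain ⟨s, hs, h⟩ := hC c hc
      exact ⟨s, ⟨hs, c, hc, h.1⟩, (h₁.trans k₁).trans h.2, (h₂.trans k₂).trans h.2⟩)
  refine ⟨x, hx, e, fun c hc => ?_⟩
  obtain ⟨s, hs, h⟩ := hC c hc
  exact ⟨s, by change s ∈ x.elems; rw [e]; exact ⟨hs, c, hc, h.1⟩, h.2⟩

/-- In a descending chain pick `d n` lost at step `n`. If `d m ≤ d n` with `m < n`, then `d n` still
lies in the set number `m + 1`, hence so does `d m`, a contradiction. -/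
theorem isDown_wf {S : Set (USet Q)} (hS : S.IsPWO) :
    WellFounded (fun A B : {D // IsDown S D} => A.1 ⊂ B.1) := by
  rw [wellFounded_iff_isEmpty_descending_chain]
  refine ⟨fun ⟨f, hf⟩ => ?_⟩
  choose d hd hd' using fun n => Set.exists_of_ssubset (hf n)
  obtain ⟨m, n, hmn, hle⟩ := exists_le_of_isPWO hS d fun n => (f n).2.1 (hd n)
  have hanti : Antitone fun n => (f n).1 := antitone_nat_of_succ_le fun n => (hf n).subset
  exact hd' m ((f (m + 1)).2.2 _ (hanti (Nat.succ_le_of_lt hmn) (hd n)) _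
    ((f m).2.1 (hd m)) hle)

/-- An upper bound of a failure of `p` and a failure of `q` would fail both. -/
theorem forall_or_forall_of_directedOn {C : Set (USet Q)} (hC : DirectedOn (· ≤ ·) C)
    {p q : USet Q → Prop} (hp : ∀ x y, x ≤ y → p y → p x) (hq : ∀ x y, x ≤ y → q y → q x)
    (h : ∀ x ∈ C, p x ∨ q x) : (∀ x ∈ C, p x) ∨ ∀ x ∈ C, q x := by
  by_contra! hcon
  obtain ⟨⟨x, hx, hpx⟩, y, hy, hqy⟩ := hcon
  obtain ⟨z, hz, hxz, hyz⟩ := hC x hx y hy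
  rcases h z hz with h | h
  · exact hpx (hp _ _ hxz h)
  · exact hqy (hq _ _ hyz h)

theorem els_subset_of_mem_IHat {U : Set Q} {α β : Ordinal.{u}} {x : USet Q}
    (h : α ≤ β + 1) (hx : x ∈ IHat U α) : els x ⊆ IHat U β := by
  rcases mem_IHat.1 hx with ⟨q, hq, rfl⟩ | ⟨γ, hγ, hx⟩
  · simpa using atom_mem_IHat hq
  · rw [els_eq (isSet_of_idealsF hx)]
    exact (subset_of_idealsF hx).trans (IHat_mono (Order.lt_add_one_iff.1 (hγ.trans_le h)))

theorem directedOn_els {U : Set Q} {α : Ordinal.{u}} {x : USet Q} (hx : x ∈ IHat U α) :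
    DirectedOn (· ≤ ·) (els x) := by
  rcases mem_IHat.1 hx with ⟨q, hq, rfl⟩ | ⟨γ, hγ, hx⟩
  · rw [els_atom]; exact directedOn_singleton _
  · rw [els_eq (isSet_of_idealsF hx)]
    exact hx.2.2.2

theorem els_nonempty {U : Set Q} {α : Ordinal.{u}} {x : USet Q} (hx : x ∈ IHat U α) :
    (els x).Nonempty := by
  rcases mem_IHat.1 hx with ⟨q, hq, rfl⟩ | ⟨γ, hγ, hx⟩
  · simp
  · rw [els_eq (isSet_of_idealsF hx)]
    exact hx.2.1

/-- One step of the hierarchy over a well quasi-order is well-founded. -/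
theorem IHat_add_one_wf {U : Set Q} {β : Ordinal.{u}} (h : (IHat U β).IsPWO) :
    (IHat U (β + 1)).WellFoundedOn (· < ·) := by
  -- Sending an object to the downward closed set that its elements generate in level β is strictly
  -- monotone, so the chain condition of `isDown_wf` pulls back.
  let g : IHat U (β + 1) → {D // IsDown (IHat U β) D} := fun x =>
    ⟨{z ∈ IHat U β | ∃ x' ∈ els x.1, z ≤ x'}, fun _ hz => hz.1,
      fun d ⟨_, c, hc, hd⟩ z hz hzd => ⟨hz, c, hc, hzd.trans hd⟩⟩
  refine Subrelation.wf (fun {x y} hxy => ?_) (InvImage.wf g (isDown_wf h))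
  refine Set.ssubset_iff_subset_ne.2 ⟨fun z ⟨hz, x', hx', hzx⟩ => ?_, fun heq => ?_⟩
  · obtain ⟨y', hy', h'⟩ := le_iff.1 (show x.1 < y.1 from hxy).le x' hx'
    exact ⟨hz, y', hy', hzx.trans h'⟩
  · refine (show x.1 < y.1 from hxy).not_ge (le_iff.2 fun y' hy' => ?_)
    have : y' ∈ (g y).1 := ⟨els_subset_of_mem_IHat le_rfl y.2 hy', y', hy', le_rfl⟩
    rw [← heq] at this
    exact this.2

end Hierarchy

section Monoid

variable {Q : Type u} [Preorder Q] [Monoid Q]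

/-- This would fail for the empty set; nonemptiness of ideals makes 1 a least element of the
hierarchy. -/
theorem one_le_of_mem_IHat (hQ : ∀ q : Q, 1 ≤ q) {U : Set Q} {α : Ordinal.{u}} {x : USet Q}
    (hx : x ∈ IHat U α) : 1 ≤ x := by
  induction α using WellFoundedLT.induction generalizing x with
  | _ α ih =>
    rcases mem_IHat.1 hx with ⟨q, hq, rfl⟩ | ⟨γ, hγ, hx'⟩
    · exact atom_le_atom.2 (hQ q)
    · obtain ⟨z, hz⟩ := hx'.2.1
      exact atom_le.2 ⟨z, (mem_els hx'.1).2 hz, ih γ hγ (subset_of_idealsF hx' hz)⟩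

theorem hatMul_spec {α : Ordinal.{u}} {x y : USet Q}
    (h : ∃ z ∈ IHat (Set.univ : Set Q) α, z.Equi (x * y)) :
    hatMul α x y ∈ IHat (Set.univ : Set Q) α ∧ (hatMul α x y).Equi (x * y) := by
  have h' : ∃ γ ≤ α, (∃ z, z ∈ mulCandidates x y γ) ∧ ∀ δ < γ, ¬ ∃ z, z ∈ mulCandidates x y δ := by
    obtain ⟨γ, hγ, hmin⟩ := WellFounded.has_min (wellFounded_lt (α := Ordinal.{u}))
      {γ | ∃ z, z ∈ mulCandidates x y γ} ⟨α, h⟩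
    exact ⟨γ, not_lt.1 (hmin α h), hγ, fun δ hδ hz => hmin δ hz hδ⟩
  unfold hatMul
  rw [dif_pos h']
  have := h'.choose_spec.2.1.choose_spec
  exact ⟨IHat_mono h'.choose_spec.1 this.1, this.2⟩

/-- The `+`-property of a set of objects, for products of arbitrary objects. -/
def Splits (S : Set (USet Q)) : Prop :=
  ∀ c ∈ S, ∀ y z : USet Q, c ≤ y * z → ∃ a ∈ S, ∃ b ∈ S, a ≤ y ∧ b ≤ z ∧ c.Equi (a * b)

variable [MulLeftMono Q] [MulRightMono Q]

theorem Equi.mul {x x' y y' : USet Q} (h : x.Equi x') (h' : y.Equi y') :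
    (x * y).Equi (x' * y') :=
  ⟨mul_le_mul' h.1 h'.1, mul_le_mul' h.2 h'.2⟩

/-- The hierarchy is closed under products, up to equivalence. -/
theorem exists_equi_mul {α : Ordinal.{u}}
    (H : ∀ δ < α, (IHat (Set.univ : Set Q) δ).IsPWO) {x y : USet Q}
    (hx : x ∈ IHat (Set.univ : Set Q) α) (hy : y ∈ IHat (Set.univ : Set Q) α) :
    ∃ z ∈ IHat (Set.univ : Set Q) α, z.Equi (x * y) := by
  induction α using WellFoundedLT.induction generalizing x y with
  | _ α ih =>
    by_cases hs : (x * y).IsSet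
    -- The elements of both factors must lie in one level δ whose ideals are available at α.
    · obtain ⟨δ, hδ, hx', hy'⟩ : ∃ δ < α, x ∈ IHat (Set.univ : Set Q) (δ + 1) ∧
          y ∈ IHat (Set.univ : Set Q) (δ + 1) := by
        rcases mem_IHat.1 hx with ⟨q, hq, rfl⟩ | ⟨γ, hγ, hx'⟩ <;>
          rcases mem_IHat.1 hy with ⟨r, hr, rfl⟩ | ⟨γ', hγ', hy'⟩
        · simp at hs
        · exact ⟨γ', hγ', atom_mem_IHat hq, mem_IHat_of_idealsF (Order.lt_add_one_iff.2 le_rfl) hy'⟩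
        · exact ⟨γ, hγ, mem_IHat_of_idealsF (Order.lt_add_one_iff.2 le_rfl) hx', atom_mem_IHat hr⟩
        · refine ⟨max γ γ', max_lt hγ hγ', mem_IHat_of_idealsF ?_ hx', mem_IHat_of_idealsF ?_ hy'⟩
          · exact Order.lt_add_one_iff.2 (le_max_left _ _)
          · exact Order.lt_add_one_iff.2 (le_max_right _ _)
      obtain ⟨z, hz, e, h⟩ := exists_idealsF_of_directed (C := els (x * y)) (H δ hδ)
        (by
          obtain ⟨a, ha⟩ := els_nonempty hx
          obtain ⟨b, hb⟩ := els_nonempty hy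
          exact ⟨_, mul_mem_els ha hb⟩)
        (by
          intro v hv w hw
          obtain ⟨a, ha, b, hb, rfl⟩ := mem_els_mul.1 hv
          obtain ⟨a', ha', b', hb', rfl⟩ := mem_els_mul.1 hw
          obtain ⟨c, hc, h₁, h₂⟩ := directedOn_els hx a ha a' ha'
          obtain ⟨d, hd, k₁, k₂⟩ := directedOn_els hy b hb b' hb'
          exact ⟨_, mul_mem_els hc hd, mul_le_mul' h₁ k₁, mul_le_mul' h₂ k₂⟩)
        (by
          intro v hv
          obtain ⟨a, ha, b, hb, rfl⟩ := mem_els_mul.1 hv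
          exact ih δ hδ (fun ε hε => H ε (hε.trans hδ)) (els_subset_of_mem_IHat le_rfl hx' ha)
            (els_subset_of_mem_IHat le_rfl hy' hb))
      refine ⟨z, mem_IHat_of_idealsF hδ hz, le_iff.2 fun w hw => ?_, le_iff.2 fun w hw => ?_⟩
      · rw [els_eq hz.1, e] at hw
        exact hw.2
      · rw [els_eq hz.1]
        exact h w hw
    · rw [isSet_mul_iff] at hs
      push Not at hs
      obtain ⟨p, rfl⟩ := (isSet_or_atom x).resolve_left hs.1
      obtain ⟨q, rfl⟩ := (isSet_or_atom y).resolve_left hs.2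
      exact ⟨_, atom_mem_IHat (Set.mem_univ (p * q)), Equi.refl _⟩

/-- Choose downward closed `A'` and `B'` inside `A` and `B` whose products still cover `x`,
lexicographically minimal. Discarding from `A'` or from `B'` everything above one of its elements
destroys the cover. As `x` is directed, if each element of `x` survives one of two such reductions,
then one of the reductions covers all of `x`. This forces `A'` and `B'` to be directed and their
products to lie below elements of `x`. -/
theorem exists_equi_mul_of_cover {S : Set (USet Q)} [Small.{u} S] (hS : S.IsPWO) (hsp : Splits S)
    {x : USet Q} (hx : x ∈ IdealsF S) {A B : Set (USet Q)} (hA : IsDown S A) (hB : IsDown S B)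
    (hc : ∀ c ∈ x, ∃ a ∈ A, ∃ b ∈ B, c ≤ a * b) :
    ∃ a ∈ IdealsF S, ∃ b ∈ IdealsF S, a.elems ⊆ A ∧ b.elems ⊆ B ∧ x.Equi (a * b) := by
  have hdir : DirectedOn (· ≤ ·) x.elems := hx.2.2.2
  let cov : Set (USet Q) → Set (USet Q) → USet Q → Prop := fun A B c => ∃ a ∈ A, ∃ b ∈ B, c ≤ a * b
  have hcov : ∀ A B c d, c ≤ d → cov A B d → cov A B c := fun A B c d h ⟨a, ha, b, hb, h'⟩ =>
    ⟨a, ha, b, hb, h.trans h'⟩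
  obtain ⟨⟨A', B'⟩, ⟨hA', hB', hc'⟩, hmin⟩ := WellFounded.has_min
    (WellFounded.prod_lex (isDown_wf hS) (isDown_wf hS))
    {p | p.1.1 ⊆ A ∧ p.2.1 ⊆ B ∧ ∀ c ∈ x, cov p.1.1 p.2.1 c}
    ⟨⟨⟨A, hA⟩, ⟨B, hB⟩⟩, subset_rfl, subset_rfl, hc⟩
  have hminA : ∀ a ∈ A'.1, ¬ ∀ c ∈ x, cov {z ∈ A'.1 | ¬ a ≤ z} B'.1 c := fun a ha h =>
    hmin ⟨⟨_, A'.2.sep a⟩, B'⟩ ⟨fun z hz => hA' hz.1, hB', h⟩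
      (.left _ _ (sep_ssubset ha))
  have hminB : ∀ b ∈ B'.1, ¬ ∀ c ∈ x, cov A'.1 {z ∈ B'.1 | ¬ b ≤ z} c := fun b hb h =>
    hmin ⟨A', ⟨_, B'.2.sep b⟩⟩ ⟨hA', fun z hz => hB' hz.1, h⟩
      (.right _ (sep_ssubset hb))
  have hdirA : DirectedOn (· ≤ ·) A'.1 := by
    intro a₁ h₁ a₂ h₂
    by_contra! hcon
    refine (forall_or_forall_of_directedOn hdir (hcov _ _) (hcov _ _) fun c hcx => ?_).elim
      (hminA a₁ h₁) (hminA a₂ h₂)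
    obtain ⟨a, ha, b, hb, h⟩ := hc' c hcx
    by_cases h₁a : a₁ ≤ a
    · exact .inr ⟨a, ⟨ha, fun h₂a => hcon a ha h₁a h₂a⟩, b, hb, h⟩
    · exact .inl ⟨a, ⟨ha, h₁a⟩, b, hb, h⟩
  have hdirB : DirectedOn (· ≤ ·) B'.1 := by
    intro b₁ h₁ b₂ h₂
    by_contra! hcon
    refine (forall_or_forall_of_directedOn hdir (hcov _ _) (hcov _ _) fun c hcx => ?_).elim
      (hminB b₁ h₁) (hminB b₂ h₂)
    obtain ⟨a, ha, b, hb, h⟩ := hc' c hcx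
    by_cases h₁b : b₁ ≤ b
    · exact .inr ⟨a, ha, b, ⟨hb, fun h₂b => hcon b hb h₁b h₂b⟩, h⟩
    · exact .inl ⟨a, ha, b, ⟨hb, h₁b⟩, h⟩
  have hle : ∀ a ∈ A'.1, ∀ b ∈ B'.1, ∃ c ∈ x, a * b ≤ c := by
    intro a₀ h₁ b₀ h₂
    by_contra! hcon
    refine (forall_or_forall_of_directedOn hdir (hcov _ _) (hcov _ _) fun c hcx => ?_).elim
      (hminA a₀ h₁) (hminB b₀ h₂)
    obtain ⟨a, ha, b, hb, h⟩ := hc' c hcx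
    -- The equivalence of `c` and `a' * b'` matters: `a₀ ≤ a'` and `b₀ ≤ b'` would give `a₀ * b₀ ≤
    -- c`. So `c` is covered without the part above `a₀` or without the part above `b₀`.
    obtain ⟨a', ha', b', hb', haa, hbb, h'⟩ := hsp c (subset_of_idealsF hx hcx) a b h
    by_cases h₁a : a₀ ≤ a'
    · exact .inr ⟨a', A'.2.2 a ha a' ha' haa, b', ⟨B'.2.2 b hb b' hb' hbb, fun h₂b =>
        hcon c hcx ((mul_le_mul' h₁a h₂b).trans h'.2)⟩, h'.1⟩
    · exact .inl ⟨a', ⟨A'.2.2 a ha a' ha' haa, h₁a⟩, b', B'.2.2 b hb b' hb' hbb, h'.1⟩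
  obtain ⟨c, hcx⟩ := hx.2.1
  obtain ⟨a₀, ha₀, b₀, hb₀, -⟩ := hc' c hcx
  obtain ⟨a, ha, rfla⟩ := exists_idealsF hS A'.2 ⟨a₀, ha₀⟩ hdirA
  obtain ⟨b, hb, rflb⟩ := exists_idealsF hS B'.2 ⟨b₀, hb₀⟩ hdirB
  refine ⟨a, ha, b, hb, rfla ▸ hA', rflb ▸ hB', le_iff.2 fun c hcx => ?_, le_iff.2 fun w hw => ?_⟩
  · rw [els_eq hx.1] at hcx
    obtain ⟨a', ha', b', hb', h⟩ := hc' c hcx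
    refine ⟨a' * b', mul_mem_els ?_ ?_, h⟩
    · rwa [els_eq ha.1, rfla]
    · rwa [els_eq hb.1, rflb]
  · obtain ⟨a', ha', b', hb', rfl⟩ := mem_els_mul.1 hw
    rw [els_eq ha.1, rfla] at ha'
    rw [els_eq hb.1, rflb] at hb'
    rw [els_eq hx.1]
    exact hle a' ha' b' hb'

/-- By induction the elements of an ideal below `y * z` split, so the ideal is covered by the
downward closed sets that the elements of `y` and of `z` generate one level down, and
`exists_equi_mul_of_cover` applies. `Splits` admits arbitrary `y` and `z` because their elements
need not lie in the level of the elements of the ideal. -/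
theorem splits_IHat (hQ : ∀ u v w : Q, u ≤ v * w → ∃ a b, u = a * b ∧ a ≤ v ∧ b ≤ w)
    {α : Ordinal.{u}} (H : ∀ δ < α, (IHat (Set.univ : Set Q) δ).IsPWO) :
    Splits (IHat (Set.univ : Set Q) α) := by
  induction α using WellFoundedLT.induction with
  | _ α ih =>
    intro x hx y z hle
    rcases mem_IHat.1 hx with ⟨q, -, rfl⟩ | ⟨δ, hδ, hx'⟩
    -- `ind₃` replaces its first argument by an element too, so a variable `t` equivalent to the
    -- urelement takes its place.
    · have key : ∀ t y z : USet Q, t.Equi (atom q) → atom q ≤ y * z →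
          ∃ a b : Q, q = a * b ∧ atom a ≤ y ∧ atom b ≤ z := by
        intro t y z
        induction t, y, z using ind₃ with
        | _ t y z ih =>
          intro ht h
          by_cases hs : y.IsSet ∨ z.IsSet
          · obtain ⟨w, hw, h'⟩ := atom_le.1 h
            obtain ⟨y', hy', z', hz', rfl⟩ := mem_els_mul.1 hw
            obtain ⟨t', ht', hqt⟩ := atom_le.1 ht.2
            have htq := le_atom.1 ht.1 t' ht'
            obtain ⟨a, b, hab, ha, hb⟩ := ih (.inr hs) t' ht' y' hy' z' hz' ⟨htq, hqt⟩ h'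
            exact ⟨a, b, hab, atom_le.2 ⟨y', hy', ha⟩, atom_le.2 ⟨z', hz', hb⟩⟩
          · push Not at hs
            obtain ⟨v, rfl⟩ := (isSet_or_atom y).resolve_left hs.1
            obtain ⟨w, rfl⟩ := (isSet_or_atom z).resolve_left hs.2
            exact hQ q v w h
      obtain ⟨a, b, rfl, ha, hb⟩ := key (atom q) y z (Equi.refl _) hle
      exact ⟨_, atom_mem_IHat (Set.mem_univ a), _, atom_mem_IHat (Set.mem_univ b), ha, hb,
        Equi.refl _⟩
    · have hsp := ih δ hδ fun ε hε => H ε (hε.trans hδ)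
      have hdown : ∀ y : USet Q, IsDown (IHat Set.univ δ)
          {a ∈ IHat (Set.univ : Set Q) δ | ∃ y' ∈ els y, a ≤ y'} := fun y =>
        ⟨fun _ h => h.1, fun d ⟨_, c, hc, hd⟩ z hz hzd => ⟨hz, c, hc, hzd.trans hd⟩⟩
      obtain ⟨a, ha, b, hb, hay, hbz, h⟩ := exists_equi_mul_of_cover (H δ hδ) hsp hx'
        (hdown y) (hdown z) (by
          intro c hc
          obtain ⟨w, hw, h⟩ := le_iff.1 hle c ((mem_els hx'.1).2 hc)
          obtain ⟨y', hy', z', hz', rfl⟩ := mem_els_mul.1 hw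
          obtain ⟨a, ha, b, hb, hay, hbz, h'⟩ := hsp c (subset_of_idealsF hx' hc) y' z' h
          exact ⟨a, ⟨ha, y', hy', hay⟩, b, ⟨hb, z', hz', hbz⟩, h'.1⟩)
      refine ⟨a, mem_IHat_of_idealsF hδ ha, b, mem_IHat_of_idealsF hδ hb,
        le_iff.2 fun a' ha' => ?_, le_iff.2 fun b' hb' => ?_, h⟩
      · rw [els_eq ha.1] at ha'
        exact (hay ha').2
      · rw [els_eq hb.1] at hb'
        exact (hbz hb').2

end Monoid

end USet

/-! ### Primes, factorizations and thin elements over the finite sequences. -/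

namespace USet

variable {P : Type u} [Preorder P]

/-- The hierarchy over the finite sequences in `P`. -/
abbrev WHat (P : Type u) [Preorder P] (α : Ordinal.{u}) : Set (USet (FreeMonoid P)) :=
  IHat (Set.univ : Set (FreeMonoid P)) α

/-- All levels below `α` of the hierarchy over the finite sequences in `P` are well
quasi-orders. -/
def PWOBelow (P : Type u) [Preorder P] (α : Ordinal.{u}) : Prop := ∀ δ < α, (WHat P δ).IsPWO

theorem PWOBelow.mono {α β : Ordinal.{u}} (H : PWOBelow P α) (h : β ≤ α) : PWOBelow P β :=
  fun δ hδ => H δ (hδ.trans_le h)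

theorem one_le_of_mem_WHat {α : Ordinal.{u}} {x : USet (FreeMonoid P)} (hx : x ∈ WHat P α) :
    1 ≤ x :=
  one_le_of_mem_IHat one_le_word hx

theorem splits_WHat {α : Ordinal.{u}} (H : PWOBelow P α) : Splits (WHat P α) :=
  splits_IHat (fun _ _ _ => exists_mul_of_le_mul) H

theorem le_mul_right_of_mem {α : Ordinal.{u}} {x y : USet (FreeMonoid P)} (hy : y ∈ WHat P α) :
    x ≤ x * y := by
  simpa using mul_le_mul_right (one_le_of_mem_WHat hy) x

theorem le_mul_left_of_mem {α : Ordinal.{u}} {x y : USet (FreeMonoid P)} (hy : y ∈ WHat P α) :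
    x ≤ y * x := by
  simpa using mul_le_mul_left (one_le_of_mem_WHat hy) x

theorem one_le_prod {α : Ordinal.{u}} {l : List (USet (FreeMonoid P))}
    (hl : ∀ x ∈ l, x ∈ WHat P α) : 1 ≤ l.prod := by
  induction l with
  | nil => simp
  | cons a l ih =>
    rw [List.prod_cons]
    simpa using mul_le_mul' (one_le_of_mem_WHat (hl a (by simp)))
      (ih fun p hp => hl p (by simp [hp]))

theorem hatMul_mem {α : Ordinal.{u}} (H : PWOBelow P α) {x y : USet (FreeMonoid P)}
    (hx : x ∈ WHat P α) (hy : y ∈ WHat P α) : hatMul α x y ∈ WHat P α :=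
  (hatMul_spec (exists_equi_mul H hx hy)).1

theorem hatMul_equi {α : Ordinal.{u}} (H : PWOBelow P α) {x y : USet (FreeMonoid P)}
    (hx : x ∈ WHat P α) (hy : y ∈ WHat P α) : (hatMul α x y).Equi (x * y) :=
  (hatMul_spec (exists_equi_mul H hx hy)).2

theorem hatProd_spec {α : Ordinal.{u}} (H : PWOBelow P α) (l : List (USet (FreeMonoid P)))
    (hl : ∀ x ∈ l, x ∈ WHat P α) : hatProd α l ∈ WHat P α ∧ (hatProd α l).Equi l.prod := by
  induction l with
  | nil => exact ⟨atom_mem_IHat (Set.mem_univ _), Equi.refl _⟩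
  | cons x l ih =>
    cases l with
    | nil => simpa [hatProd] using ⟨hl x (by simp), Equi.refl _⟩
    | cons y l =>
      obtain ⟨h₁, h₂⟩ := ih fun z hz => hl z (List.mem_cons_of_mem _ hz)
      have hx := hl x (by simp)
      refine ⟨hatMul_mem H hx h₁, (hatMul_equi H hx h₁).trans ?_⟩
      rw [List.prod_cons]
      exact (Equi.refl x).mul h₂

theorem isMultiplicativeQo_WHat {α : Ordinal.{u}} (H : PWOBelow P α) :
    IsMultiplicativeQo (WHat P α) (· ≤ ·) (hatMul α) where
  op_mem _ hx _ hy := hatMul_mem H hx hy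
  refl _ _ := le_rfl
  trans _ _ _ _ _ _ h h' := h.trans h'
  assoc x hx y hy z hz := by
    have h₁ : (hatMul α (hatMul α x y) z).Equi (x * y * z) :=
      (hatMul_equi H (hatMul_mem H hx hy) hz).trans ((hatMul_equi H hx hy).mul (Equi.refl z))
    have h₂ : (hatMul α x (hatMul α y z)).Equi (x * (y * z)) :=
      (hatMul_equi H hx (hatMul_mem H hy hz)).trans ((Equi.refl x).mul (hatMul_equi H hy hz))
    rw [mul_assoc] at h₁
    exact h₁.trans h₂.symm
  le_op x hx y hy := (le_mul_right_of_mem hy).trans (hatMul_equi H hx hy).2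
  mono x hx x' hx' y hy y' hy' h h' :=
    ((hatMul_equi H hx hy).1.trans (mul_le_mul' h h')).trans (hatMul_equi H hx' hy').2

theorem hasPlusProperty_WHat {α : Ordinal.{u}} (H : PWOBelow P α) :
    HasPlusProperty (WHat P α) (· ≤ ·) (hatMul α) := by
  intro a ha b hb c hc h
  obtain ⟨a', ha', b', hb', haa, hbb, h'⟩ :=
    splits_WHat H c hc a b (h.trans (hatMul_equi H ha hb).1)
  have := h'.trans (hatMul_equi H ha' hb').symm
  exact ⟨a', ha', b', hb', haa, hbb, this.1, this.2⟩

/-- The chosen product is replaced by the plain one; since 1 is least, acting neutrally means being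
below 1. -/
theorem mem_prim {α : Ordinal.{u}} (H : PWOBelow P α) {x : USet (FreeMonoid P)} :
    x ∈ Prim (FreeMonoid P) α ↔ x ∈ WHat P α ∧ ¬ x ≤ 1 ∧
      ∀ y ∈ WHat P α, ∀ z ∈ WHat P α, x.Equi (y * z) → x.Equi y ∨ x.Equi z := by
  refine and_congr_right fun hx => and_congr ?_ ?_
  · constructor
    · rintro ⟨y, hy, h⟩ hx1
      refine h ((hatMul_equi H hx hy).trans ⟨?_, le_mul_left_of_mem hx⟩)
      simpa using mul_le_mul_left hx1 y
    · intro h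
      have h1 : (1 : USet (FreeMonoid P)) ∈ WHat P α := atom_mem_IHat (Set.mem_univ _)
      refine ⟨1, h1, fun h' => h ?_⟩
      simpa using (hatMul_equi H hx h1).2.trans h'.1
  · refine forall₄_congr fun y hy z hz => imp_congr_left ⟨fun h => ?_, fun h => ?_⟩
    · exact h.trans (hatMul_equi H hy hz)
    · exact h.trans (hatMul_equi H hy hz).symm

/-- A lower level offers fewer factorizations to test. -/
theorem prim_of_le {α β : Ordinal.{u}} (H : PWOBelow P α) (h : β ≤ α) {x : USet (FreeMonoid P)}
    (hx : x ∈ Prim (FreeMonoid P) α) (hx' : x ∈ WHat P β) : x ∈ Prim (FreeMonoid P) β := by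
  rw [mem_prim H] at hx
  exact (mem_prim (H.mono h)).2 ⟨hx', hx.2.1, fun y hy z hz =>
    hx.2.2 y (IHat_mono h hy) z (IHat_mono h hz)⟩

/-- Primality is applied to the product of the first letter and the remaining word; lengths decide
both alternatives. -/
theorem exists_of_prim_atom {α : Ordinal.{u}} (H : PWOBelow P α) {w : FreeMonoid P}
    (h : atom w ∈ Prim (FreeMonoid P) α) : ∃ p, w = FreeMonoid.of p := by
  obtain ⟨-, h₁, h₂⟩ := (mem_prim H).1 h
  cases w using FreeMonoid.casesOn with
  | one => exact (h₁ le_rfl).elim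
  | of_mul p w =>
    rcases h₂ (atom (FreeMonoid.of p)) (atom_mem_IHat (Set.mem_univ _)) (atom w)
      (atom_mem_IHat (Set.mem_univ _)) (Equi.refl _) with h | h
    · have := length_le_of_word_le (atom_le_atom.1 h.1)
      refine ⟨p, ?_⟩
      have hw : w.toList = [] := by simpa using this
      have : w = 1 := hw
      simp [this]
    · have := length_le_of_word_le (atom_le_atom.1 h.1)
      simp at this

theorem atom_of_mem_prim (p : P) : atom (FreeMonoid.of p) ∈ Prim (FreeMonoid P) 0 := by
  refine (mem_prim fun δ hδ => (not_lt_zero hδ).elim).2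
    ⟨atom_mem_IHat (Set.mem_univ _), fun h => ?_, fun y hy z hz h => ?_⟩
  · have := length_le_of_word_le (atom_le_atom.1 h)
    simp at this
  · rcases mem_IHat.1 hy with ⟨v, -, rfl⟩ | ⟨δ, hδ, -⟩
    swap
    · exact (not_lt_zero hδ).elim
    rcases mem_IHat.1 hz with ⟨w, -, rfl⟩ | ⟨δ, hδ, -⟩
    swap
    · exact (not_lt_zero hδ).elim
    have := length_le_of_word_le (atom_le_atom.1 h.2)
    have hlen : v.toList.length + w.toList.length ≤ 1 := by simpa using this
    rcases Nat.eq_zero_or_pos v.toList.length with h0 | h0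
    · have h1 : v = 1 := List.length_eq_zero_iff.1 h0
      subst h1
      exact .inr (by simpa using h)
    · have h1 : w = 1 := List.length_eq_zero_iff.1
        (show w.toList.length = 0 by omega)
      subst h1
      exact .inl (by simpa using h)

/-- An element that is neither prime nor below 1 is a product of two strictly smaller ones.
Well-foundedness is a separate hypothesis so that the lemma applies to a level not yet known to be a
well quasi-order. -/
theorem exists_prim_factors {α : Ordinal.{u}} (H : PWOBelow P α)
    (hwf : (WHat P α).WellFoundedOn (· < ·)) {x : USet (FreeMonoid P)} (hx : x ∈ WHat P α) :
    ∃ l : List (USet (FreeMonoid P)), (∀ p ∈ l, p ∈ Prim (FreeMonoid P) α) ∧ x.Equi l.prod := by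
  refine hwf.induction hx (P := fun x => ∃ l : List (USet (FreeMonoid P)),
    (∀ p ∈ l, p ∈ Prim (FreeMonoid P) α) ∧ x.Equi l.prod) ?_
  intro x hx ih
  by_cases h1 : x ≤ 1
  · exact ⟨[], by simp, h1, one_le_of_mem_WHat hx⟩
  by_cases hp : x ∈ Prim (FreeMonoid P) α
  · exact ⟨[x], by simpa using hp, by simpa using Equi.refl x⟩
  · rw [mem_prim H] at hp
    push Not at hp
    obtain ⟨y, hy, z, hz, h, hxy, hxz⟩ := hp hx h1
    have hyx : y ≤ x := (le_mul_right_of_mem hz).trans h.2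
    have hzx : z ≤ x := (le_mul_left_of_mem hy).trans h.2
    obtain ⟨l, hl, hyl⟩ := ih y hy (lt_of_le_not_ge hyx fun h' => hxy ⟨h', hyx⟩)
    obtain ⟨l', hl', hzl⟩ := ih z hz (lt_of_le_not_ge hzx fun h' => hxz ⟨h', hzx⟩)
    refine ⟨l ++ l', fun p hp => (List.mem_append.1 hp).elim (hl p) (hl' p), h.trans ?_⟩
    rw [List.prod_append]
    exact hyl.mul hzl

theorem wellFoundedOn_of_isPWO {S : Set (USet (FreeMonoid P))} (h : S.IsPWO) :
    S.WellFoundedOn (· < ·) := h.isWF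

theorem mem_fDom_of_prim {α β : Ordinal.{u}} (h : β ≤ α) {x : USet (FreeMonoid P)}
    (hx : x ∈ Prim (FreeMonoid P) β) : x ∈ fDom P α := ⟨β, h, hx⟩

theorem fDom_mono {α β : Ordinal.{u}} (h : β ≤ α) : fDom P β ⊆ fDom P α :=
  fun _ ⟨γ, hγ, hx⟩ => ⟨γ, hγ.trans h, hx⟩

/-- An ideal of level β < α already belongs to level β + 1 ≤ α, which is well-founded because level
β is a well quasi-order. Nothing is needed about level α itself, which avoids circularity. -/
theorem exists_fDom_factors {α : Ordinal.{u}} (H : PWOBelow P α) {x : USet (FreeMonoid P)}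
    (hx : x ∈ WHat P α) :
    ∃ l : List (USet (FreeMonoid P)), (∀ p ∈ l, p ∈ fDom P α) ∧ x.Equi l.prod := by
  rcases mem_IHat.1 hx with ⟨w, -, rfl⟩ | ⟨β, hβ, hx⟩
  · induction w using FreeMonoid.recOn with
    | one => exact ⟨[], by simp, Equi.refl _⟩
    | of_mul p w ih =>
      obtain ⟨l, hl, h⟩ := ih (atom_mem_IHat (Set.mem_univ _))
      refine ⟨atom (FreeMonoid.of p) :: l, ?_, ?_⟩
      · simpa using ⟨mem_fDom_of_prim zero_le (atom_of_mem_prim p), hl⟩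
      · rw [List.prod_cons, ← atom_mul_atom]
        exact (Equi.refl _).mul h
  · have hβ' : β + 1 ≤ α := Order.add_one_le_iff.2 hβ
    obtain ⟨l, hl, h⟩ := exists_prim_factors (H.mono hβ') (IHat_add_one_wf (H β hβ))
      (mem_IHat_of_idealsF (Order.lt_add_one_iff.2 le_rfl) hx)
    exact ⟨l, fun p hp => mem_fDom_of_prim hβ' (hl p hp), h⟩

/-- Every element of an ideal of `Î_γ` is a product of primes that belong to the ideal. -/
theorem exists_factors_of_mem {γ : Ordinal.{u}} (H : PWOBelow P (γ + 1))
    {x x' : USet (FreeMonoid P)} (hx : x ∈ IdealsF (WHat P γ)) (hx' : x' ∈ x) :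
    ∃ l : List (USet (FreeMonoid P)), (∀ p ∈ l, p ∈ x ∧ p ∈ Prim (FreeMonoid P) γ) ∧
      x'.Equi l.prod := by
  have Hγ : PWOBelow P γ := H.mono (Order.lt_add_one_iff.2 le_rfl).le
  obtain ⟨l, hl, h⟩ := exists_prim_factors Hγ
    (wellFoundedOn_of_isPWO (H γ (Order.lt_add_one_iff.2 le_rfl))) (subset_of_idealsF hx hx')
  refine ⟨l, fun p hp => ⟨(isDown_of_idealsF hx).2 x' hx' p (hl p hp).1 ?_, hl p hp⟩, h⟩
  -- The other factors are above 1, so `p` lies below `x'`.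
  obtain ⟨l₁, l₂, rfl⟩ := List.append_of_mem hp
  refine le_trans ?_ h.2
  rw [List.prod_append, List.prod_cons]
  have k₁ := one_le_prod (l := l₁) fun p hp => (hl p (List.mem_append_left _ hp)).1
  have k₂ := one_le_prod (l := l₂) fun p hp => (hl p (by simp [hp])).1
  simpa using mul_le_mul' k₁ (mul_le_mul_right k₂ p)

/-- No sequence of length two is below `x`. -/
def Thin (x : USet (FreeMonoid P)) : Prop :=
  ∀ p q : P, ¬ atom (FreeMonoid.of p * FreeMonoid.of q) ≤ x

theorem Thin.mono {x y : USet (FreeMonoid P)} (hy : Thin y) (h : x ≤ y) : Thin x :=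
  fun p q h' => hy p q (h'.trans h)

theorem le_of_mem_els_atom {w : FreeMonoid P} {x x' : USet (FreeMonoid P)} (hx : x' ∈ els x)
    (h : atom w ≤ x') : atom w ≤ x := atom_le.2 ⟨x', hx, h⟩

theorem Thin.of_mem {x x' : USet (FreeMonoid P)} (hx : Thin x) (h : x' ∈ els x) : Thin x' :=
  fun p q h' => hx p q (le_of_mem_els_atom h h')

theorem thin_of (p : P) : Thin (atom (FreeMonoid.of p)) := fun q r h => by
  have := length_le_of_word_le (atom_le_atom.1 h)
  simp at this

theorem thin_of_mem_IHat {α : Ordinal.{u}} {y : USet (FreeMonoid P)}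
    (hy : y ∈ IHat (Set.range (FreeMonoid.of : P → FreeMonoid P)) α) : Thin y := by
  induction α using WellFoundedLT.induction generalizing y with
  | _ α ih =>
    rcases mem_IHat.1 hy with ⟨w, ⟨p, rfl⟩, rfl⟩ | ⟨β, hβ, hx⟩
    · exact thin_of p
    · intro p q h
      obtain ⟨z, hz, h⟩ := atom_le.1 h
      exact ih β hβ (subset_of_idealsF hx ((mem_els hx.1).1 hz)) p q h

theorem exists_of_le {x : USet (FreeMonoid P)} (h : ¬ x ≤ 1) :
    ∃ p, atom (FreeMonoid.of p) ≤ x := by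
  induction x using mem_induction with
  | _ x ih =>
    rcases isSet_or_atom x with hx | ⟨w, rfl⟩
    · rw [one_def, le_atom] at h
      push Not at h
      obtain ⟨x', hx', h⟩ := h
      obtain ⟨p, hp⟩ := ih x' ((mem_els hx).1 hx') h
      exact ⟨p, le_of_mem_els_atom hx' hp⟩
    · cases w using FreeMonoid.casesOn with
      | one => exact (h le_rfl).elim
      | of_mul p w =>
        refine ⟨p, atom_le_atom.2 ?_⟩
        simpa using mul_le_mul_right (one_le_word w) (FreeMonoid.of p)

theorem exists_WHat_equi {α : Ordinal.{u}} (H : PWOBelow P α) {y : USet (FreeMonoid P)}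
    (hy : y ∈ IHat (Set.range (FreeMonoid.of : P → FreeMonoid P)) α) :
    ∃ x ∈ WHat P α, x.Equi y := by
  induction α using WellFoundedLT.induction generalizing y with
  | _ α ih =>
    rcases mem_IHat.1 hy with ⟨w, -, rfl⟩ | ⟨β, hβ, hx⟩
    · exact ⟨_, atom_mem_IHat (Set.mem_univ w), Equi.refl _⟩
    · obtain ⟨x, hx', e, h⟩ := exists_idealsF_of_directed (H β hβ) hx.2.1 hx.2.2.2
        fun c hc => ih β hβ (H.mono hβ.le) (subset_of_idealsF hx hc)
      refine ⟨x, mem_IHat_of_idealsF hβ hx', le_iff.2 fun w hw => ?_, le_iff.2 fun w hw => ?_⟩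
      · rw [els_eq hx'.1, e] at hw
        rw [els_eq hx.1]
        exact hw.2
      · rw [els_eq hx.1] at hw
        rw [els_eq hx'.1]
        exact h w hw

theorem isPWO_of_equi {Q : Type*} [Preorder Q] {S T : Set (USet Q)} (hS : S.IsPWO)
    (h : ∀ t ∈ T, ∃ s ∈ S, s.Equi t) : T.IsPWO := by
  intro f
  choose g hg hg' using fun n => h (f n).1 (f n).2
  obtain ⟨m, n, hmn, hle⟩ := exists_le_of_isPWO hS g hg
  exact ⟨m, n, hmn, ((hg' m).2.trans hle).trans (hg' n).1⟩

/-- Elements below 1 can be dropped from `x`: some `x₀` in `x` is not below 1, yet above it, so the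
rest is cofinal. Together with `thin_of_mem_IHat` this shows that the second clause of `fMap` tests
for thinness. -/
theorem exists_IHat_equi_of_thin {α : Ordinal.{u}} (H : PWOBelow P α) {x : USet (FreeMonoid P)}
    (hx : x ∈ WHat P α) (ht : Thin x) (h1 : ¬ x ≤ 1) :
    ∃ y ∈ IHat (Set.range (FreeMonoid.of : P → FreeMonoid P)) α, y.Equi x := by
  induction α using WellFoundedLT.induction generalizing x with
  | _ α ih =>
    rcases mem_IHat.1 hx with ⟨w, -, rfl⟩ | ⟨β, hβ, hx'⟩
    · cases w using FreeMonoid.casesOn with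
      | one => exact (h1 le_rfl).elim
      | of_mul p w =>
        cases w using FreeMonoid.casesOn with
        | one => exact ⟨_, atom_mem_IHat ⟨p, rfl⟩, by simpa using Equi.refl _⟩
        | of_mul q w =>
          refine (ht p q (atom_le_atom.2 ?_)).elim
          simpa using mul_le_mul_right (mul_le_mul_right (one_le_word w) (FreeMonoid.of q))
            (FreeMonoid.of p)
    · have h1' := h1
      rw [one_def, le_atom] at h1
      push Not at h1
      obtain ⟨x₀, hx₀, h₀⟩ := h1
      rw [els_eq hx'.1] at hx₀
      have hpwo : (IHat (Set.range (FreeMonoid.of : P → FreeMonoid P)) β).IsPWO :=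
        isPWO_of_equi (H β hβ) fun t => exists_WHat_equi (H.mono hβ.le)
      obtain ⟨y, hy, e, h⟩ := exists_idealsF_of_directed (C := {c ∈ x.elems | ¬ c ≤ 1}) hpwo
        ⟨x₀, hx₀, h₀⟩
        (by
          intro a ha b hb
          obtain ⟨c, hc, hac, hbc⟩ := hx'.2.2.2 a ha.1 b hb.1
          exact ⟨c, ⟨hc, fun h => ha.2 (hac.trans h)⟩, hac, hbc⟩)
        (fun c hc => ih β hβ (H.mono hβ.le) (subset_of_idealsF hx' hc.1)
          (ht.of_mem ((mem_els hx'.1).2 hc.1)) hc.2)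
      refine ⟨y, mem_IHat_of_idealsF hβ hy, le_iff.2 fun w hw => ?_, le_iff.2 fun w hw => ?_⟩
      · rw [els_eq hy.1, e] at hw
        rw [els_eq hx'.1]
        obtain ⟨-, c, hc, h⟩ := hw
        exact ⟨c, hc.1, h⟩
      · rw [els_eq hx'.1] at hw
        rw [els_eq hy.1]
        by_cases hw1 : w ≤ 1
        · obtain ⟨z, hz, h'⟩ := h x₀ ⟨hx₀, h₀⟩
          exact ⟨z, hz, hw1.trans ((one_le_of_mem_WHat (subset_of_idealsF hx' hx₀)).trans h')⟩
        · exact h w ⟨hw, hw1⟩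

/-- Take the shortest prefix with product above `u`: `m` is its last factor, `l₁` what precedes and
`l₂` what follows. If `v` were below the product of `l₂`, then `u * v` would be below the whole
product. Without such a prefix, `l₁` is the whole list. -/
theorem exists_split_list {u v : USet (FreeMonoid P)} (hu : ¬ u ≤ 1) (hv : ¬ v ≤ 1)
    (l : List (USet (FreeMonoid P))) (h : ¬ u * v ≤ l.prod) :
    ∃ l₁ m l₂ : List (USet (FreeMonoid P)), l = l₁ ++ (m ++ l₂) ∧ m.length ≤ 1 ∧
      ¬ u ≤ l₁.prod ∧ ¬ v ≤ l₂.prod := by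
  by_cases hul : u ≤ l.prod
  swap
  · exact ⟨l, [], [], by simp, by simp, hul, by simpa using hv⟩
  obtain ⟨k, hk, hmin⟩ := WellFounded.has_min (wellFounded_lt (α := ℕ))
    {k | u ≤ (l.take k).prod} ⟨l.length, by simpa using hul⟩
  have hk0 : k ≠ 0 := by
    rintro rfl
    exact hu (by simpa using hk)
  obtain ⟨j, rfl⟩ := Nat.exists_eq_succ_of_ne_zero hk0
  refine ⟨l.take j, (l.drop j).take 1, (l.drop j).drop 1, by simp, by simp,
    fun h' => hmin j h' (Nat.lt_succ_self j), fun h' => h ?_⟩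
  rw [List.drop_drop] at h'
  rw [← List.take_append_drop (j + 1) l, List.prod_append]
  exact mul_le_mul' hk h'

end USet

/-! ### The dichotomy for primes. -/

namespace USet

variable {P : Type u} [Preorder P]

/-- A prime ideal is either thin or multiplicatively closed. -/
theorem thin_or_mul_le {α : Ordinal.{u}} (H : PWOBelow P α) {x : USet (FreeMonoid P)}
    (hx : x ∈ Prim (FreeMonoid P) α) : Thin x ∨ x * x ≤ x := by
  induction α using WellFoundedLT.induction generalizing x with
  | _ α ih =>
    rcases mem_IHat.1 hx.1 with ⟨w, -, rfl⟩ | ⟨β, hβ, hI⟩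
    · obtain ⟨p, rfl⟩ := exists_of_prim_atom H hx
      exact .inl (thin_of p)
    by_cases hm : x * x ≤ x
    · exact .inr hm
    have hβ' : β + 1 ≤ α := Order.add_one_le_iff.2 hβ
    have hββ : β < β + 1 := Order.lt_add_one_iff.2 le_rfl
    have H' := H.mono hβ'
    have Hβ := H.mono hβ.le
    have hp := ((mem_prim H').1 (prim_of_le H hβ' hx (mem_IHat_of_idealsF hββ hI))).2.2
    have hels : els x = x.elems := els_eq hI.1
    obtain ⟨u, hu, v, hv, huv⟩ : ∃ u ∈ x, ∃ v ∈ x, ∀ w ∈ x, ¬ u * v ≤ w := by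
      rw [le_iff] at hm
      push Not at hm
      obtain ⟨z, hz, h⟩ := hm
      obtain ⟨u, hu, v, hv, rfl⟩ := mem_els_mul.1 hz
      rw [hels] at hu hv h
      exact ⟨u, hu, v, hv, h⟩
    have hu1 : ¬ u ≤ 1 := fun h => huv v hv (by simpa using mul_le_mul_left h v)
    have hv1 : ¬ v ≤ 1 := fun h => huv u hu (by simpa using mul_le_mul_right h u)
    have hS := H β hβ
    have hsp := splits_WHat Hβ
    have hxS : x.elems ⊆ WHat P β := subset_of_idealsF hI
    have hxD := isDown_of_idealsF hI
    -- The prime factorization of any element of `x` is cut by `exists_split_list` into a part not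
    -- above `u`, at most one prime of `x`, and a part not above `v`. So `x` is covered by three
    -- downward closed sets: `C` is for the middle part, `B` for the last one.
    let C : Set (USet (FreeMonoid P)) :=
      {z ∈ WHat P β | z ≤ 1 ∨ ∃ p ∈ x, p ∈ Prim (FreeMonoid P) β ∧ z ≤ p}
    let B : Set (USet (FreeMonoid P)) := {z ∈ x.elems | ¬ v ≤ z}
    have hC : IsDown (WHat P β) C := ⟨fun z hz => hz.1, fun d hd z hz hzd => ⟨hz, hd.2.imp hzd.trans
      fun ⟨p, hp, hp', h⟩ => ⟨p, hp, hp', hzd.trans h⟩⟩⟩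
    have hCB : IsDown (WHat P β) {z ∈ WHat P β | ∃ c ∈ C, ∃ b ∈ B, z ≤ c * b} :=
      ⟨fun z hz => hz.1, fun d hd z hz hzd => ⟨hz, by
        obtain ⟨c, hc, b, hb, h⟩ := hd.2
        exact ⟨c, hc, b, hb, hzd.trans h⟩⟩⟩
    have hprod : ∀ l : List (USet (FreeMonoid P)), (∀ p ∈ l, p ∈ WHat P β) →
        ∃ a ∈ WHat P β, a.Equi l.prod := fun l hl => ⟨_, hatProd_spec Hβ l hl⟩
    obtain ⟨a, ha, d, hd, haA, hdCB, hxad⟩ := exists_equi_mul_of_cover hS hsp hI (hxD.sep u) hCB (by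
      intro w hw
      obtain ⟨l, hl, h⟩ := exists_factors_of_mem H' hI hw
      obtain ⟨l₁, m, l₂, rfl, hm1, hl₁, hl₂⟩ :=
        exists_split_list hu1 hv1 l fun h' => huv w hw (h'.trans h.2)
      have m₁ : ∀ p ∈ l₁, p ∈ WHat P β := fun p hp => (hl p (by simp [hp])).2.1
      have m₂ : ∀ p ∈ m, p ∈ WHat P β := fun p hp => (hl p (by simp [hp])).2.1
      have m₃ : ∀ p ∈ l₂, p ∈ WHat P β := fun p hp => (hl p (by simp [hp])).2.1
      obtain ⟨a, ha, hal⟩ := hprod l₁ m₁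
      obtain ⟨b, hb, hbl⟩ := hprod l₂ m₃
      have hmC : m.prod ∈ C := by
        match m, hm1, m₂, hl with
        | [], _, _, _ => exact ⟨atom_mem_IHat (Set.mem_univ _), .inl le_rfl⟩
        | [p], _, m₂, hl =>
          have hp := hl p (by simp)
          exact ⟨by simpa using m₂, .inr ⟨p, hp.1, hp.2, by simp⟩⟩
      have hw' : w.Equi (l₁.prod * (m.prod * l₂.prod)) := by simpa using h
      have k₁ : l₁.prod ≤ w := by
        refine le_trans ?_ hw'.2
        simpa using mul_le_mul_right (mul_le_mul' (one_le_prod m₂) (one_le_prod m₃)) l₁.prod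
      have k₂ : l₂.prod ≤ w := by
        refine le_trans ?_ hw'.2
        simpa using mul_le_mul' (one_le_prod m₁) (mul_le_mul_left (one_le_prod m₂) l₂.prod)
      obtain ⟨z, hz, hzm⟩ := exists_equi_mul Hβ hmC.1 hb
      refine ⟨a, ⟨hxD.2 w hw a ha (hal.1.trans k₁), fun h' => hl₁ (h'.trans hal.1)⟩,
        z, ⟨hz, _, hmC, b, ⟨hxD.2 w hw b hb (hbl.1.trans k₂), fun h' => hl₂ (h'.trans hbl.1)⟩,
          hzm.1⟩, hw'.1.trans ?_⟩
      exact mul_le_mul' hal.2 ((mul_le_mul_right hbl.2 _).trans hzm.2))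
    obtain ⟨c, hc, b, hb, hcC, hbB, hdcb⟩ := exists_equi_mul_of_cover hS hsp hd hC (hxD.sep v)
      fun z hz => (hdCB hz).2
    -- An object whose elements avoid everything above some `t` in `x` cannot be equivalent to `x`.
    -- So primality rejects the outer factors `a` and `b`, and `x` is equivalent to the middle
    -- factor `c`.
    have hup : ∀ t ∈ x, ∀ a : USet (FreeMonoid P), a.IsSet → a.elems ⊆ {z ∈ x.elems | ¬ t ≤ z} →
        ¬ x.Equi a := fun t ht a has hsub h => by
      obtain ⟨z, hz, h'⟩ := le_iff.1 h.1 t (by rw [hels]; exact ht)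
      rw [els_eq has] at hz
      exact (hsub hz).2 h'
    have hxd : x.Equi d := (hp a (mem_IHat_of_idealsF hββ ha) d (mem_IHat_of_idealsF hββ hd)
      hxad).resolve_left (hup u hu a ha.1 haA)
    have hxc : x.Equi c := (hp c (mem_IHat_of_idealsF hββ hc) b (mem_IHat_of_idealsF hββ hb)
      (hxd.trans hdcb)).resolve_right (hup v hv b hb.1 hbB)
    -- Now each element of `x` is below 1 or below a prime in `x`. A common bound `t` of `u`, `v`
    -- and an element above a two-letter word lies below such a prime `p`, which is not thin. By
    -- induction `p * p ≤ p`, so `u * v ≤ p`, against the choice of `u` and `v`.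
    refine .inl fun q r hqr => ?_
    obtain ⟨w, hw, hqr⟩ := atom_le.1 hqr
    rw [hels] at hw
    obtain ⟨t₁, ht₁, hut, hvt⟩ := hI.2.2.2 u hu v hv
    obtain ⟨t, ht, ht₁t, hwt⟩ := hI.2.2.2 t₁ ht₁ w hw
    obtain ⟨z, hz, htz⟩ := le_iff.1 hxc.1 t (by rw [hels]; exact ht)
    rw [els_eq hc.1] at hz
    rcases (hcC hz).2 with h | ⟨p, hpx, hp, hzp⟩
    · exact hu1 (((hut.trans ht₁t).trans htz).trans h)
    · have htp := htz.trans hzp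
      rcases ih β hβ Hβ hp with h | h
      · exact h q r ((hqr.trans hwt).trans htp)
      · exact huv p hpx ((mul_le_mul' ((hut.trans ht₁t).trans htp)
          ((hvt.trans ht₁t).trans htp)).trans h)

end USet

/-! ### The maps f_α are total and order-reflecting. -/

section FMapValues

open USet

variable {P : Type u} [Preorder P]

theorem fMap_zero (p : P) : fMap P 0 (atom (FreeMonoid.of p)) = some (atom (Sum.inl p)) := by
  have h : ∃ q : P, atom (FreeMonoid.of p) = atom (FreeMonoid.of q) := ⟨p, rfl⟩
  unfold fMap
  rw [Ordinal.limitRecOn_zero, dif_pos h]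
  rw [FreeMonoid.of_injective (atom_injective h.choose_spec.symm)]

/-- A description of the possible pairs of an element of the domain and its value under `f_α`. -/
inductive FDesc (α : Ordinal.{u}) (x : USet (FreeMonoid P)) (v : USet (P ⊕ Unit)) : Prop
  | letter (p : P) (hx : x = atom (FreeMonoid.of p)) (hv : v = atom (Sum.inl p))
  | thin (β : Ordinal.{u}) (hβ : β < α) (hx : x ∈ IdealsF (WHat P β)) (ht : Thin x)
      (hv : v = ofSet (imageSet (fDom P β) (fMap P β) x))
  | closed (β : Ordinal.{u}) (hβ : β < α) (hx : x ∈ IdealsF (WHat P β)) (hm : x * x ≤ x)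
      (hv : v = ofSet (insert (atom (Sum.inr ())) (imageSet (fDom P β) (fMap P β) x)))

theorem FDesc.mono {α β : Ordinal.{u}} (h : β ≤ α) {x : USet (FreeMonoid P)} {v : USet (P ⊕ Unit)}
    (hd : FDesc β x v) : FDesc α x v := by
  cases hd with
  | letter p hx hv => exact .letter p hx hv
  | thin γ hγ hx ht hv => exact .thin γ (hγ.trans_le h) hx ht hv
  | closed γ hγ hx ht hv => exact .closed γ (hγ.trans_le h) hx ht hv

theorem not_le_one_of_mem_fDom {α : Ordinal.{u}} (H : PWOBelow P α) {x : USet (FreeMonoid P)}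
    (hx : x ∈ fDom P α) : ¬ x ≤ 1 := by
  obtain ⟨β, hβ, hx⟩ := hx
  exact ((mem_prim (H.mono hβ)).1 hx).2.1

/-- `f_α` is defined on its whole domain. -/
theorem exists_fMap_eq {α : Ordinal.{u}} (H : PWOBelow P α) {x : USet (FreeMonoid P)}
    (hx : x ∈ fDom P α) : ∃ v, fMap P α x = some v ∧ FDesc α x v := by
  induction α using WellFoundedLT.induction generalizing x with
  | _ α ih =>
    by_cases hex : ∃ δ < α, x ∈ fDom P δ
    · obtain ⟨δ, hδ, hx'⟩ := hex
      obtain ⟨v, hv, hd⟩ := ih δ hδ (H.mono hδ.le) hx'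
      exact ⟨v, by rw [fMap_eq_of_mem_fDom P hδ.le hx', hv], hd.mono hδ.le⟩
    push Not at hex
    obtain ⟨δ, hδ, hp⟩ := hx
    obtain rfl : δ = α := by
      by_contra hne
      exact hex δ (lt_of_le_of_ne hδ hne) ⟨δ, le_rfl, hp⟩
    rcases mem_IHat.1 hp.1 with ⟨w, -, rfl⟩ | ⟨β, hβ, hI⟩
    · obtain ⟨p, rfl⟩ := exists_of_prim_atom H hp
      refine ⟨atom (Sum.inl p), ?_, .letter p rfl rfl⟩
      rw [fMap_eq_of_mem_fDom P (zero_le (a := δ)) ⟨0, le_rfl, atom_of_mem_prim p⟩, fMap_zero]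
    have hββ : β < β + 1 := Order.lt_add_one_iff.2 le_rfl
    have hp' := prim_of_le H (Order.add_one_le_iff.2 hβ) hp (mem_IHat_of_idealsF hββ hI)
    -- As `x` is already prime at level β + 1 and belongs to no earlier domain, the level is this
    -- successor and the successor clause of the recursion applies.
    obtain rfl : β + 1 = δ := by
      by_contra hne
      exact hex _ (lt_of_le_of_ne (Order.add_one_le_iff.2 hβ) hne) ⟨_, le_rfl, hp'⟩
    have hall : ∀ x' ∈ x.elems ∩ fDom P β, fMap P β x' ≠ none := fun x' hx' h => by
      obtain ⟨v, hv, -⟩ := ih β hβ (H.mono hβ.le) hx'.2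
      simp [h] at hv
    have e : ∃ v, v = fMap P (β + 1) x := ⟨_, rfl⟩
    obtain ⟨v, hv⟩ := e
    have hv' := hv
    unfold fMap at hv
    rw [Ordinal.limitRecOn_add_one, if_neg (hex β hβ)] at hv
    rw [← hv']
    clear hv'
    split_ifs at hv with h₁ h₂
    · obtain ⟨⟨y, hy, hyx⟩, -⟩ := h₁
      exact ⟨_, hv, .thin β hβ hI ((thin_of_mem_IHat hy).mono hyx.2) rfl⟩
    · obtain ⟨-, y, -, hy, hyx⟩ := h₂
      refine ⟨_, hv, .closed β hβ hI ((mul_le_mul' hyx.2 hyx.2).trans (le_trans ?_ hyx.1)) rfl⟩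
      refine le_iff.2 fun z hz => ?_
      obtain ⟨a, ha, b, hb, rfl⟩ := mem_els_mul.1 hz
      rw [els_eq hy.1] at ha hb ⊢
      exact hy.2 a ha b hb
    · exfalso
      rcases thin_or_mul_le H hp with ht | hm
      · exact h₁ ⟨exists_IHat_equi_of_thin H hp.1 ht (not_le_one_of_mem_fDom H ⟨_, le_rfl, hp⟩),
          hall⟩
      · refine h₂ ⟨hall, x, hI, ⟨hI.1, fun y hy z hz => ?_⟩, Equi.refl x⟩
        have := le_iff.1 hm (y * z) (mul_mem_els ((mem_els hI.1).2 hy) ((mem_els hI.1).2 hz))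
        rwa [els_eq hI.1] at this

theorem fDesc_of_fMap_eq {α : Ordinal.{u}} (H : PWOBelow P α) {x : USet (FreeMonoid P)}
    (hx : x ∈ fDom P α) {v : USet (P ⊕ Unit)} (hv : fMap P α x = some v) : FDesc α x v := by
  obtain ⟨w, hw, hd⟩ := exists_fMap_eq H hx
  rw [hv, Option.some_inj] at hw
  exact hw ▸ hd

/-- A prime ideal is not below 1, so it contains a prime of lower level, and the descent ends at a
letter. Hence no value is built from ⋆ alone. -/
theorem exists_inl_le {α : Ordinal.{u}} (H : PWOBelow P α) {x : USet (FreeMonoid P)}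
    (hx : x ∈ fDom P α) {v : USet (P ⊕ Unit)} (hv : fMap P α x = some v) :
    ∃ p, atom (Sum.inl p) ≤ v := by
  induction α using WellFoundedLT.induction generalizing x v with
  | _ α ih =>
    have key : ∀ β < α, x ∈ IdealsF (WHat P β) →
        ∃ z ∈ imageSet (fDom P β) (fMap P β) x, ∃ p, atom (Sum.inl p) ≤ z := by
      intro β hβ hI
      have h1 := not_le_one_of_mem_fDom H hx
      rw [one_def, le_atom] at h1
      push Not at h1
      obtain ⟨x', hx', h1⟩ := h1
      rw [els_eq hI.1] at hx'
      obtain ⟨l, hl, h⟩ := exists_factors_of_mem (H.mono (Order.add_one_le_iff.2 hβ)) hI hx'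
      cases l with
      | nil => exact (h1 (by simpa [one_def] using h.1)).elim
      | cons a l =>
        obtain ⟨hax, hap⟩ := hl a (by simp)
        have haD := mem_fDom_of_prim le_rfl hap
        obtain ⟨z, hz, -⟩ := exists_fMap_eq (H.mono hβ.le) haD
        exact ⟨z, ⟨a, ⟨hax, haD⟩, hz⟩, ih β hβ (H.mono hβ.le) haD hz⟩
    rcases fDesc_of_fMap_eq H hx hv with ⟨p, -, rfl⟩ | ⟨β, hβ, hI, -, rfl⟩ | ⟨β, hβ, hI, -, rfl⟩
    · exact ⟨p, le_rfl⟩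
    · obtain ⟨z, hz, p, hp⟩ := key β hβ hI
      exact ⟨p, atom_le.2 ⟨z, (mem_els (isSet_ofSet _)).2 (mem_ofSet.2 hz), hp⟩⟩
    · obtain ⟨z, hz, p, hp⟩ := key β hβ hI
      exact ⟨p, atom_le.2 ⟨z, (mem_els (isSet_ofSet _)).2 (mem_ofSet.2 (.inr hz)), hp⟩⟩

theorem not_le_star {α : Ordinal.{u}} (H : PWOBelow P α) {x : USet (FreeMonoid P)}
    (hx : x ∈ fDom P α) {v : USet (P ⊕ Unit)} (hv : fMap P α x = some v) :
    ¬ v ≤ atom (Sum.inr ()) := fun h => by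
  obtain ⟨p, hp⟩ := exists_inl_le H hx hv
  have := atom_le_atom.1 (hp.trans h)
  simp at this

/-- A thin prime cannot satisfy `x * x ≤ x`: it is above some letter `p` and would be above the word
pp. So ⋆ below a value reveals that the prime is not thin. -/
theorem not_star_le {α : Ordinal.{u}} (H : PWOBelow P α) {x : USet (FreeMonoid P)}
    (hx : x ∈ fDom P α) (ht : Thin x) {v : USet (P ⊕ Unit)} (hv : fMap P α x = some v) :
    ¬ atom (Sum.inr ()) ≤ v := by
  induction α using WellFoundedLT.induction generalizing x v with
  | _ α ih =>
    rcases fDesc_of_fMap_eq H hx hv with ⟨p, -, rfl⟩ | ⟨β, hβ, hI, -, rfl⟩ | ⟨β, hβ, hI, hm, rfl⟩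
    · simp
    · intro h
      obtain ⟨z, hz, h⟩ := atom_le.1 h
      obtain ⟨x', hx', hz⟩ := mem_ofSet.1 ((mem_els (isSet_ofSet _)).1 hz)
      exact ih β hβ (H.mono hβ.le) hx'.2 (ht.of_mem ((mem_els hI.1).2 hx'.1)) hz h
    · obtain ⟨p, hp⟩ := exists_of_le (not_le_one_of_mem_fDom H hx)
      exact (ht p p ((mul_le_mul' hp hp).trans hm)).elim

/-- The urelement found may differ from `q`; `VDot` only asks for one to exist. -/
theorem exists_transGen_of_atom_le {Q : Type u} [Preorder Q] {q : Q} {v : USet Q} (h : atom q ≤ v)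
    (hv : v.IsSet) : ∃ q' : Q, Relation.TransGen (fun a b => a ∈ b) (atom q') v := by
  induction v using mem_induction with
  | _ v ih =>
    obtain ⟨z, hz, h⟩ := atom_le.1 h
    rw [mem_els hv] at hz
    rcases isSet_or_atom z with hs | ⟨r, rfl⟩
    · obtain ⟨q', hq'⟩ := ih z hz h hs
      exact ⟨q', hq'.tail hz⟩
    · exact ⟨r, .single hz⟩

theorem mem_VDot_of_fMap_eq {α : Ordinal.{u}} (H : PWOBelow P α) {x : USet (FreeMonoid P)}
    (hx : x ∈ fDom P α) {v : USet (P ⊕ Unit)} (hv : fMap P α x = some v) :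
    v ∈ VDot (P ⊕ Unit) α := by
  induction α using WellFoundedLT.induction generalizing x v with
  | _ α ih =>
    have hex := exists_inl_le H hx hv
    have key : ∀ β < α, ∀ z ∈ imageSet (fDom P β) (fMap P β) x, z.IsSet → z.rank < β := by
      rintro β hβ z ⟨x', hx', hz⟩ hs
      rcases ih β hβ (H.mono hβ.le) hx'.2 hz with ⟨q, rfl⟩ | h
      · exact (not_isSet_atom _ hs).elim
      · exact h.2.1
    obtain ⟨p, hp⟩ := hex
    rcases fDesc_of_fMap_eq H hx hv with ⟨p, -, rfl⟩ | ⟨β, hβ, hI, -, rfl⟩ | ⟨β, hβ, hI, hm, rfl⟩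
    · exact .inl ⟨_, rfl⟩
    · refine .inr ⟨isSet_ofSet _, lt_of_le_of_lt ?_ hβ, exists_transGen_of_atom_le hp (isSet_ofSet _)⟩
      exact (rank_le_iff (isSet_ofSet _)).2 fun z hz => key β hβ z (mem_ofSet.1 hz)
    · refine .inr ⟨isSet_ofSet _, lt_of_le_of_lt ?_ hβ, exists_transGen_of_atom_le hp (isSet_ofSet _)⟩
      refine (rank_le_iff (isSet_ofSet _)).2 fun z hz hs => ?_
      rcases mem_ofSet.1 hz with rfl | hz
      · exact (not_isSet_atom _ hs).elim
      · exact key β hβ z hz hs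

theorem prod_le_of_mul_le {y : USet (FreeMonoid P)} {l : List (USet (FreeMonoid P))}
    (hm : y * y ≤ y) (h1 : ∃ z ∈ els y, 1 ≤ z) (hl : ∀ p ∈ l, ∃ z ∈ els y, p ≤ z) :
    ∃ z ∈ els y, l.prod ≤ z := by
  induction l with
  | nil => simpa using h1
  | cons a l ih =>
    obtain ⟨z, hz, h⟩ := ih fun p hp => hl p (by simp [hp])
    obtain ⟨z', hz', h'⟩ := hl a (by simp)
    obtain ⟨w, hw, h''⟩ := le_iff.1 hm _ (mul_mem_els hz' hz)
    exact ⟨w, hw, by simpa using (mul_le_mul' h' h).trans h''⟩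

/-- The elements of a value of `f_α` are `⋆` and values of lower level. -/
theorem FDesc.exists_els {α : Ordinal.{u}} {y : USet (FreeMonoid P)}
    {w z : USet (P ⊕ Unit)} (hd : FDesc α y w) (hz : z ∈ els w) :
    z = atom (Sum.inr ()) ∨ (∃ p, y = atom (FreeMonoid.of p) ∧ z = atom (Sum.inl p)) ∨
      ∃ β < α, ∃ y' ∈ els y, y' ∈ fDom P β ∧ fMap P β y' = some z := by
  rcases hd with ⟨p, rfl, rfl⟩ | ⟨β, hβ, hI, -, rfl⟩ | ⟨β, hβ, hI, -, rfl⟩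
  · exact .inr (.inl ⟨p, rfl, by simpa using hz⟩)
  · obtain ⟨y', hy', h⟩ := mem_ofSet.1 ((mem_els (isSet_ofSet _)).1 hz)
    exact .inr (.inr ⟨β, hβ, y', (mem_els hI.1).2 hy'.1, hy'.2, h⟩)
  · rcases mem_ofSet.1 ((mem_els (isSet_ofSet _)).1 hz) with rfl | ⟨y', hy', h⟩
    · exact .inl rfl
    · exact .inr (.inr ⟨β, hβ, y', (mem_els hI.1).2 hy'.1, hy'.2, h⟩)

/-- Every prime is above a letter, so two prime factors put a two-letter word below the product. -/
theorem Thin.length_le_one {α : Ordinal.{u}} (H : PWOBelow P α) {l : List (USet (FreeMonoid P))}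
    (hl : ∀ p ∈ l, p ∈ Prim (FreeMonoid P) α) (ht : Thin l.prod) : l.length ≤ 1 := by
  match l, hl, ht with
  | [], _, _ => simp
  | [a], _, _ => simp
  | a :: b :: l, hl, ht =>
    obtain ⟨p, hp⟩ := exists_of_le ((mem_prim H).1 (hl a (by simp))).2.1
    obtain ⟨q, hq⟩ := exists_of_le ((mem_prim H).1 (hl b (by simp))).2.1
    refine (ht p q ?_).elim
    have : 1 ≤ l.prod := one_le_prod fun x hx => (hl x (by simp [hx])).1
    rw [← atom_mul_atom]
    simpa using mul_le_mul' hp (mul_le_mul' hq this)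

/-- `f_α` is order-reflecting. -/
theorem le_of_fMap_le {α : Ordinal.{u}} (H : PWOBelow P α) {x y : USet (FreeMonoid P)}
    (hx : x ∈ fDom P α) (hy : y ∈ fDom P α) {v w : USet (P ⊕ Unit)} (hv : fMap P α x = some v)
    (hw : fMap P α y = some w) (hle : v ≤ w) : x ≤ y := by
  induction α using WellFoundedLT.induction generalizing x y v w with
  | _ α ih =>
    have hdx := fDesc_of_fMap_eq H hx hv
    have hdy := fDesc_of_fMap_eq H hy hw
    -- An element of `w` above `v'` is not ⋆ by `not_le_star`. So it is the value of the letter `y`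
    -- or of an element of `y` at some level γ < α, and the induction hypothesis at the larger of β
    -- and γ compares the arguments.
    have hlow : ∀ β < α, ∀ x' ∈ fDom P β, ∀ v', fMap P β x' = some v' → (∃ z ∈ els w, v' ≤ z) →
        ∃ y' ∈ els y, x' ≤ y' := by
      rintro β hβ x' hx' v' hv' ⟨z, hz, hle⟩
      rcases hdy.exists_els hz with rfl | ⟨p, rfl, rfl⟩ | ⟨γ, hγ, y', hyy', hy', hz⟩
      · exact (not_le_star (H.mono hβ.le) hx' hv' hle).elim
      · refine ⟨atom (FreeMonoid.of p), by simp, ?_⟩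
        have h0 : atom (FreeMonoid.of p) ∈ fDom P 0 := ⟨0, le_rfl, atom_of_mem_prim p⟩
        exact ih β hβ (H.mono hβ.le) hx' (fDom_mono zero_le h0) hv'
          ((fMap_eq_of_mem_fDom P zero_le h0).trans (fMap_zero p)) hle
      · refine ⟨y', hyy', ih (max β γ) (max_lt hβ hγ) (H.mono (max_lt hβ hγ).le)
          (fDom_mono (le_max_left _ _) hx') (fDom_mono (le_max_right _ _) hy')
          ((fMap_eq_of_mem_fDom P (le_max_left _ _) hx').trans hv')
          ((fMap_eq_of_mem_fDom P (le_max_right _ _) hy').trans hz) hle⟩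
    obtain ⟨α', hα', hyα'⟩ : ∃ β ≤ α, y ∈ WHat P β := by
      obtain ⟨β, hβ, h⟩ := hy
      exact ⟨β, hβ, h.1⟩
    have hone : ∃ z ∈ els y, 1 ≤ z := atom_le.1 (one_le_of_mem_WHat hyα')
    rcases hdx with ⟨p, rfl, rfl⟩ | ⟨β, hβ, hI, ht, rfl⟩ | ⟨β, hβ, hI, hm, rfl⟩
    · rcases hdy with ⟨q, rfl, rfl⟩ | ⟨γ, hγ, hI, -, -⟩ | ⟨γ, hγ, hI, -, -⟩
      · exact atom_le_atom.2 (of_le_of.2 (by simpa using hle))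
      all_goals
        have h0 : atom (FreeMonoid.of p) ∈ fDom P 0 := ⟨0, le_rfl, atom_of_mem_prim p⟩
        exact atom_le.2 (hlow 0 (pos_of_gt hγ) _ h0 _ (fMap_zero p) (atom_le.1 hle))
    all_goals
      have Hβ := H.mono hβ.le
      have hel : ∀ x' ∈ x, x' ∈ Prim (FreeMonoid P) β → ∃ y' ∈ els y, x' ≤ y' := by
        intro x' hx' hp
        have hD := mem_fDom_of_prim le_rfl hp
        obtain ⟨v', hv', -⟩ := exists_fMap_eq Hβ hD
        refine hlow β hβ x' hD v' hv' (le_iff.1 hle v' ?_)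
        rw [mem_els (isSet_ofSet _), mem_ofSet]
        first
          | exact ⟨x', ⟨hx', hD⟩, hv'⟩
          | exact .inr ⟨x', ⟨hx', hD⟩, hv'⟩
      refine le_iff.2 fun x' hx' => ?_
      have hx'' := hx'
      rw [els_eq hI.1] at hx'
      obtain ⟨l, hl, h⟩ := exists_factors_of_mem (H.mono (Order.add_one_le_iff.2 hβ)) hI hx'
    -- In a thin ideal each element is equivalent to 1 or to a single prime.
    · have hlen := Thin.length_le_one Hβ (fun p hp => (hl p hp).2) ((ht.of_mem hx'').mono h.2)
      match l, hlen, hl, h with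
      | [], _, _, h =>
        obtain ⟨z, hz, h1⟩ := hone
        exact ⟨z, hz, h.1.trans (by simpa using h1)⟩
      | [a], _, hl, h =>
        obtain ⟨hax, hap⟩ := hl a (by simp)
        obtain ⟨y', hy', h'⟩ := hel a hax hap
        exact ⟨y', hy', h.1.trans (by simpa using h')⟩
    -- The mark ⋆ passes from `v` to `w`, so `y` is not thin and absorbs its square. Hence products
    -- of primes below elements of `y` stay below elements of `y`.
    · have hstar : atom (Sum.inr ()) ≤ w :=
        le_trans (atom_le.2 ⟨_, (mem_els (isSet_ofSet _)).2 (mem_ofSet.2 (.inl rfl)), le_rfl⟩) hle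
      have hyt : ¬ Thin y := fun ht => not_star_le H hy ht hw hstar
      have hym : y * y ≤ y := by
        rcases hdy with ⟨q, rfl, rfl⟩ | ⟨γ, hγ, hI, ht, -⟩ | ⟨γ, hγ, hI, hm, -⟩
        · exact (hyt (thin_of q)).elim
        · exact (hyt ht).elim
        · exact hm
      obtain ⟨z, hz, h'⟩ := prod_le_of_mul_le hym hone
        fun p hp => hel p (hl p hp).1 (hl p hp).2
      exact ⟨z, hz, h.1.trans h'⟩

end FMapValues

/-! ### Initial segments of sets of natural numbers. -/

section InitSeg

theorem InitSeg.trans {s t r : Set ℕ} (h : InitSeg s t) (h' : InitSeg t r) : InitSeg s r :=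
  ⟨h.1.trans h'.1, fun m hm n hn => by
    by_cases hnt : n ∈ t
    · exact h.2 m hm n ⟨hnt, hn.2⟩
    · exact h'.2 m (h.1 hm) n ⟨hn.1, hnt⟩⟩

theorem InitSeg.of_subset {s t r : Set ℕ} (h : InitSeg s r) (hst : s ⊆ t) (htr : t ⊆ r) :
    InitSeg s t :=
  ⟨hst, fun m hm n hn => h.2 m hm n ⟨htr hn.1, hn.2⟩⟩

theorem initSeg_empty (s : Set ℕ) : InitSeg ∅ s := ⟨by simp, by simp⟩

theorem InitSeg.total {s t r : Set ℕ} (h : InitSeg s r) (h' : InitSeg t r) :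
    InitSeg s t ∨ InitSeg t s := by
  by_cases hst : s ⊆ t
  · exact .inl (h.of_subset hst h'.1)
  · obtain ⟨m, hm, hmt⟩ := Set.not_subset.1 hst
    refine .inr (h'.of_subset (fun n hn => ?_) h.1)
    by_contra hns
    exact lt_asymm (h.2 m hm n ⟨h'.1 hn, hns⟩) (h'.2 n hn m ⟨h.1 hm, hmt⟩)

theorem InitSeg.sInf_mem {s X : Set ℕ} (h : InitSeg s X) (hs : s.Nonempty) : sInf X ∈ s := by
  obtain ⟨m, hm⟩ := hs
  by_contra hcon
  exact (h.2 m hm _ ⟨Nat.sInf_mem ⟨m, h.1 hm⟩, hcon⟩).not_ge (Nat.sInf_le (h.1 hm))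

theorem InitSeg.sInf_eq {s X : Set ℕ} (h : InitSeg s X) (hs : s.Nonempty) : sInf X = sInf s :=
  le_antisymm (Nat.sInf_le (h.1 (Nat.sInf_mem hs))) (Nat.sInf_le (h.sInf_mem hs))

theorem InitSeg.diff_singleton {s X : Set ℕ} (h : InitSeg s X) (m : ℕ) :
    InitSeg (s \ {m}) (X \ {m}) :=
  ⟨fun _ hn => ⟨h.1 hn.1, hn.2⟩, fun n hn k hk => h.2 n hn.1 k ⟨hk.1.1, fun h' => hk.2 ⟨h', hk.1.2⟩⟩⟩

theorem InitSeg.insert_sInf {s t : Set ℕ} (h : InitSeg s t) (hne : s ≠ t) :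
    ∃ n ∈ t, n ∉ s ∧ InitSeg s (insert n s) ∧ InitSeg (insert n s) t := by
  have hne' : (t \ s).Nonempty := Set.nonempty_of_ssubset ⟨h.1, fun h' => hne (h.1.antisymm h')⟩
  have hmem := Nat.sInf_mem hne'
  have hsub : insert (sInf (t \ s)) s ⊆ t := Set.insert_subset hmem.1 h.1
  refine ⟨sInf (t \ s), hmem.1, hmem.2, h.of_subset (Set.subset_insert _ _) hsub, hsub, ?_⟩
  rintro m hm n ⟨hn, hns⟩
  rw [Set.mem_insert_iff, not_or] at hns
  rcases Set.mem_insert_iff.1 hm with rfl | hm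
  · exact lt_of_le_of_ne (Nat.sInf_le ⟨hn, hns.2⟩) (Ne.symm hns.1)
  · exact h.2 m hm n ⟨hn, hns.2⟩

theorem exists_initSeg_card {X : Set ℕ} (hX : X.Infinite) (n : ℕ) :
    ∃ σ : Finset ℕ, InitSeg (σ : Set ℕ) X ∧ σ.card = n := by
  induction n with
  | zero => exact ⟨∅, by simpa using initSeg_empty X, rfl⟩
  | succ n ih =>
    obtain ⟨σ, hσ, hc⟩ := ih
    obtain ⟨m, -, hm, -, h⟩ := hσ.insert_sInf fun h => hX (h ▸ σ.finite_toSet)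
    exact ⟨insert m σ, by simpa using h, by rw [Finset.card_insert_of_notMem (by simpa using hm), hc]⟩

theorem infinite_of_forall_mem {F : Set (Finset ℕ)} {Y : Set ℕ} (hY : Y.Infinite)
    (h : ∀ n ∈ Y, ∃ σ ∈ F, n ∈ σ) : F.Infinite := fun hF => by
  refine hY ((hF.biUnion fun σ _ => σ.finite_toSet).subset fun n hn => ?_)
  obtain ⟨σ, hσ, h⟩ := h n hn
  exact Set.mem_biUnion hσ h

end InitSeg

/-! ### Fusion, and the partition theorem for fronts. -/

section Fusion

/-- Build a decreasing sequence of infinite sets, each lying beyond the minimum of the previous one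
and good for that minimum with some colour. The minima whose colour is one that occurs infinitely
often form `Y`. -/
theorem exists_diagonal (R : ℕ → Set ℕ → Prop → Prop)
    (hmono : ∀ n X Y b, Y ⊆ X → R n X b → R n Y b)
    (hstep : ∀ n X, X.Infinite → ∃ Y ⊆ X, Y.Infinite ∧ ∃ b, R n Y b) {X : Set ℕ}
    (hX : X.Infinite) : ∃ Y ⊆ X, Y.Infinite ∧ ∃ b, ∀ n ∈ Y, R n (Y ∩ Set.Ioi n) b := by
  have hinf : ∀ Z : Set ℕ, Z.Infinite → (Z ∩ Set.Ioi (sInf Z)).Infinite := fun Z hZ h =>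
    hZ ((h.union (Set.finite_Iic (sInf Z))).subset fun n hn => by
      rcases le_or_gt n (sInf Z) with h | h
      · exact .inr h
      · exact .inl ⟨hn, h⟩)
  have hstep' : ∀ Z : {Z : Set ℕ // Z.Infinite}, ∃ Z' : {Z : Set ℕ // Z.Infinite},
      Z'.1 ⊆ Z.1 ∩ Set.Ioi (sInf Z.1) ∧ ∃ b, R (sInf Z.1) Z'.1 b := fun Z => by
    obtain ⟨Y, hY, hYi, hb⟩ := hstep (sInf Z.1) _ (hinf Z.1 Z.2)
    exact ⟨⟨Y, hYi⟩, hY, hb⟩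
  choose g hg b hb using hstep'
  let Z : ℕ → {Z : Set ℕ // Z.Infinite} := fun k => g^[k] ⟨X, hX⟩
  have hZ : ∀ k, Z (k + 1) = g (Z k) := fun k => Function.iterate_succ_apply' g k _
  have hanti : Antitone fun k => (Z k).1 := antitone_nat_of_succ_le fun k => by
    rw [hZ]
    exact (hg _).trans Set.inter_subset_left
  have hmem : ∀ k, sInf (Z k).1 ∈ (Z k).1 := fun k => Nat.sInf_mem (Z k).2.nonempty
  have hlt : ∀ k, ∀ n ∈ (Z (k + 1)).1, sInf (Z k).1 < n := fun k n hn => by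
    rw [hZ] at hn
    exact (hg _ hn).2
  have hmon : StrictMono fun k => sInf (Z k).1 := strictMono_nat_of_lt_succ fun k => hlt k _ (hmem _)
  obtain ⟨c, hc⟩ : ∃ c : Prop, {k | b (Z k) = c}.Infinite := by
    by_contra! hcon
    refine Set.infinite_univ (((hcon True).union (hcon False)).subset fun k _ => ?_)
    by_cases h : b (Z k)
    · exact .inl (eq_true h)
    · exact .inr (eq_false h)
  refine ⟨(fun k => sInf (Z k).1) '' {k | b (Z k) = c}, ?_, hc.image hmon.injective.injOn, c, ?_⟩
  · rintro _ ⟨k, -, rfl⟩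
    exact hanti (Nat.zero_le k) (hmem k)
  · rintro _ ⟨k, hk, rfl⟩
    have := hb (Z k)
    rw [← hZ, show b (Z k) = c from hk] at this
    refine hmono _ _ _ _ ?_ this
    rintro _ ⟨⟨j, -, rfl⟩, hj⟩
    exact hanti (Nat.succ_le_of_lt (hmon.lt_iff_lt.1 hj)) (hmem j)

end Fusion

namespace RankedFront

theorem nonempty_of_mem (F : RankedFront.{u}) {σ : Finset ℕ} (h : σ ∈ F.carrier) :
    σ.Nonempty := by
  rw [Finset.nonempty_iff_ne_empty]
  rintro rfl
  refine F.infinite ((Set.finite_singleton ∅).subset fun τ hτ => ?_)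
  exact (F.antichain _ h τ hτ (by simpa using initSeg_empty _)).symm

/-- Covering is applied to the part of `Y` from `n` on: the member found starts with `n`. So
restricting a front to `Y` keeps all of `Y` in its support. -/
theorem exists_mem_of_mem (F : RankedFront.{u}) {Y : Set ℕ} (hY : Y.Infinite)
    (hYF : ∀ n ∈ Y, ∃ ρ ∈ F.carrier, n ∈ ρ) {n : ℕ} (hn : n ∈ Y) :
    ∃ σ ∈ F.carrier, (σ : Set ℕ) ⊆ Y ∧ n ∈ σ := by
  have hinf : (Y ∩ Set.Ici n).Infinite := fun h =>
    hY ((h.union (Set.finite_Iio n)).subset fun m hm => by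
      rcases lt_or_ge m n with h | h
      · exact .inr h
      · exact .inl ⟨hm, h⟩)
  obtain ⟨σ, hσ, h⟩ := F.covers _ hinf fun m hm => hYF m hm.1
  refine ⟨σ, hσ, h.1.trans Set.inter_subset_left, ?_⟩
  have heq : sInf (Y ∩ Set.Ici n) = n :=
    le_antisymm (Nat.sInf_le ⟨hn, le_refl n⟩) (Nat.sInf_mem hinf.nonempty).2
  exact Finset.mem_coe.1 (heq ▸ h.sInf_mem (F.nonempty_of_mem hσ))

theorem infinite_support (F : RankedFront.{u}) : {n | ∃ ρ ∈ F.carrier, n ∈ ρ}.Infinite := fun h => by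
  refine F.infinite ((Set.Finite.finite_subsets h).preimage (f := ((↑) : Finset ℕ → Set ℕ))
    Finset.coe_injective.injOn |>.subset fun σ hσ n hn => ⟨σ, hσ, hn⟩)

theorem frontTree_subset {F G : Set (Finset ℕ)} (h : G ⊆ F) : frontTree G ⊆ frontTree F := by
  rintro σ ⟨h₁, τ, hτ, h₂⟩
  exact ⟨fun n hn => let ⟨ρ, hρ, h'⟩ := h₁ n hn; ⟨ρ, h hρ, h'⟩, τ, h hτ, h₂⟩

/-- The restriction of a front to an infinite subset of its support. -/
def restrict (F : RankedFront.{u}) (Y : Set ℕ) (hY : Y.Infinite)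
    (hYF : ∀ n ∈ Y, ∃ ρ ∈ F.carrier, n ∈ ρ) : RankedFront.{u} where
  carrier := {σ ∈ F.carrier | (σ : Set ℕ) ⊆ Y}
  infinite := infinite_of_forall_mem hY fun n hn =>
    let ⟨σ, hσ, h, h'⟩ := F.exists_mem_of_mem hY hYF hn
    ⟨σ, ⟨hσ, h⟩, h'⟩
  antichain σ hσ τ hτ h := F.antichain σ hσ.1 τ hτ.1 h
  covers X hX h := by
    have hXY : X ⊆ Y := fun n hn => let ⟨ρ, hρ, h'⟩ := h n hn; hρ.2 h'
    obtain ⟨σ, hσ, h'⟩ := F.covers X hX fun n hn => hYF n (hXY hn)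
    exact ⟨σ, ⟨hσ, h'.1.trans hXY⟩, h'⟩
  rk σ := F.rk ⟨σ.1, frontTree_subset (fun _ h => h.1) σ.2⟩
  rk_lt σ τ h hne := F.rk_lt _ _ h fun h' => hne (Subtype.ext (Subtype.mk.inj h'))

theorem empty_mem_frontTree (F : RankedFront.{u}) : ∅ ∈ frontTree F.carrier := by
  obtain ⟨σ, hσ⟩ := F.infinite.nonempty
  exact ⟨by simp, σ, hσ, by simpa using initSeg_empty _, (F.nonempty_of_mem hσ).ne_empty.symm⟩

/-- Take members that are initial segments of `Y` and of `Y` without its minimum; after removal of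
the minimum from the first, both are initial segments of the same set. -/
theorem exists_shiftRel (F : RankedFront.{u}) {Y : Set ℕ} (hY : Y.Infinite)
    (hYF : ∀ n ∈ Y, ∃ ρ ∈ F.carrier, n ∈ ρ) :
    ∃ σ ∈ F.carrier, ∃ τ ∈ F.carrier, (σ : Set ℕ) ⊆ Y ∧ (τ : Set ℕ) ⊆ Y ∧ ShiftRel σ τ := by
  obtain ⟨σ, hσ, h⟩ := F.covers Y hY hYF
  have hσn := F.nonempty_of_mem hσ
  have hmin : σ.min' hσn = sInf Y := by
    refine le_antisymm (Finset.min'_le _ _ (h.sInf_mem hσn)) (Nat.sInf_le (h.1 ?_))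
    exact σ.min'_mem hσn
  obtain ⟨τ, hτ, h'⟩ := F.covers (Y \ {sInf Y}) (hY.sdiff (Set.finite_singleton _))
    fun n hn => hYF n hn.1
  have hτn := F.nonempty_of_mem hτ
  refine ⟨σ, hσ, τ, hτ, h.1, h'.1.trans Set.sdiff_subset, hσn, hτn, ?_, ?_⟩
  · rw [hmin]
    have := h'.1 (τ.min'_mem hτn)
    exact lt_of_le_of_ne (Nat.sInf_le this.1) (Ne.symm this.2)
  · rw [hmin, Finset.coe_erase]
    exact (h.diff_singleton _).total h'

/-- The **Nash-Williams partition theorem** for ranked fronts. -/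
theorem exists_homogeneous (F : RankedFront.{u}) (c : Finset ℕ → Prop) {X : Set ℕ}
    (hX : X.Infinite) :
    ∃ Y ⊆ X, Y.Infinite ∧ ∃ b : Prop, ∀ τ ∈ F.carrier, (τ : Set ℕ) ⊆ Y → (c τ ↔ b) := by
  have key : ∀ σ : frontTree F.carrier, ∀ X : Set ℕ, X.Infinite → ∃ Y ⊆ X, Y.Infinite ∧ ∃ b : Prop,
      ∀ τ ∈ F.carrier, InitSeg (σ.1 : Set ℕ) τ → (τ : Set ℕ) \ σ.1 ⊆ Y → (c τ ↔ b) := by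
    intro σ
    -- Members through σ are made monochromatic by induction on the rank of σ, diagonalizing over
    -- the next number `n`.
    induction e : F.rk σ using WellFoundedLT.induction generalizing σ with
    | _ o ih =>
      subst e
      intro X hX
      obtain ⟨Y, hYX, hY, b, hb⟩ := exists_diagonal
        (fun n Y b => ∀ τ ∈ F.carrier, n ∉ σ.1 → InitSeg (σ.1 : Set ℕ) (insert n σ.1) →
          InitSeg (insert n σ.1 : Set ℕ) τ → (τ : Set ℕ) \ (insert n σ.1) ⊆ Y → (c τ ↔ b))
        (fun n X Y b hYX h τ hτ h₁ h₂ h₃ h₄ => h τ hτ h₁ h₂ h₃ (h₄.trans hYX))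
        (by
          intro n X hX
          by_cases hex : n ∉ σ.1 ∧ InitSeg (σ.1 : Set ℕ) (insert n σ.1) ∧
            insert n σ.1 ∈ frontTree F.carrier
          · obtain ⟨hn, hi, ht⟩ := hex
            obtain ⟨Y, hYX, hY, b, hb⟩ := ih _ (F.rk_lt σ ⟨_, ht⟩ (by simpa using hi) (fun h => hn
              (by rw [h]; simp))) ⟨_, ht⟩ rfl X hX
            refine ⟨Y, hYX, hY, b, fun τ hτ _ _ h₁ h₂ => hb τ hτ (by simpa using h₁)
              (by simpa using h₂)⟩
          -- If σ with `n` added at its end is not in the tree, a member starting with it must equal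
          -- it, so its colour is settled.
          · refine ⟨X, subset_rfl, hX, c (insert n σ.1), fun τ hτ hn h₁ h₂ _ => ?_⟩
            by_cases heq : insert n σ.1 = τ
            · rw [heq]
            · refine (hex ⟨hn, h₁, fun m hm => ?_, τ, hτ, by simpa using h₂, heq⟩).elim
              exact ⟨τ, hτ, h₂.1 (by simpa using hm)⟩) hX
      refine ⟨Y, hYX, hY, b, fun τ hτ h₁ h₂ => ?_⟩
      have hne : (σ.1 : Set ℕ) ≠ τ := by
        intro h
        obtain ⟨-, ρ, hρ, h₃, h₄⟩ := σ.2
        rw [Finset.coe_injective h] at h₃ h₄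
        exact h₄ (F.antichain τ hτ ρ hρ h₃)
      obtain ⟨n, hnτ, hn, h₃, h₄⟩ := h₁.insert_sInf hne
      refine hb n (h₂ ⟨hnτ, hn⟩) τ hτ (by simpa using hn) h₃ h₄ fun m hm => ⟨?_, ?_⟩
      · exact h₂ ⟨hm.1, fun h => hm.2 (Set.mem_insert_of_mem _ h)⟩
      · exact h₄.2 n (Set.mem_insert _ _) m hm
  obtain ⟨Y, hYX, hY, b, hb⟩ := key ⟨∅, F.empty_mem_frontTree⟩ X hX
  exact ⟨Y, hYX, hY, b, fun τ hτ h => hb τ hτ (by simpa using initSeg_empty _) (by simpa using h)⟩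

end RankedFront

/-- Adding an isolated point to `P` does not create bad arrays. -/
theorem not_badArray_sum {P : Type u} [Preorder P] {ζ : Ordinal.{u}}
    (hP : ∀ F : RankedFront.{u}, F.RankLT ζ → ∀ f : F.carrier → P, ¬ BadArray F f)
    (F : RankedFront.{u}) (hF : F.RankLT ζ) (f : F.carrier → P ⊕ Unit) : ¬ BadArray F f := by
  intro hbad
  obtain ⟨Y, hYF, hY, b, hb⟩ := F.exists_homogeneous
    (fun σ => ∃ h : σ ∈ F.carrier, f ⟨σ, h⟩ = Sum.inr ()) F.infinite_support
  -- Either the array is constantly ⋆ on `Y` and any shift pair there is good, or its restriction to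
  -- `Y` takes values in `P` and the root keeps its rank.
  by_cases hb' : b
  · obtain ⟨σ, hσ, τ, hτ, hσY, hτY, h⟩ := F.exists_shiftRel hY hYF
    obtain ⟨_, h₁⟩ := (hb σ hσ hσY).2 hb'
    obtain ⟨_, h₂⟩ := (hb τ hτ hτY).2 hb'
    exact hbad ⟨σ, hσ⟩ ⟨τ, hτ⟩ h (by rw [h₁, h₂])
  · have hg : ∀ σ : (F.restrict Y hY hYF).carrier, ∃ p, f ⟨σ.1, σ.2.1⟩ = Sum.inl p := by
      rintro ⟨σ, hσ⟩
      rcases h : f ⟨σ, hσ.1⟩ with p | ⟨⟩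
      · exact ⟨p, rfl⟩
      · exact (hb' ((hb σ hσ.1 hσ.2).1 ⟨hσ.1, h⟩)).elim
    choose g hg using hg
    obtain ⟨h, hlt⟩ := hF
    refine hP (F.restrict Y hY hYF) ⟨RankedFront.empty_mem_frontTree _, hlt⟩ g fun σ τ h hle => ?_
    refine hbad ⟨σ.1, σ.2.1⟩ ⟨τ.1, τ.2.1⟩ h ?_
    rw [hg, hg]
    exact Sum.inl_le_inl_iff.2 hle

/-! ### From bad sequences of sets to bad arrays of urelements. -/

namespace USet

variable {R : Type u} [Preorder R]

/-- `v` lies above some urelement. -/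
def HasAtom (v : USet R) : Prop := ∃ q, atom q ≤ v

/-- Elements of `v` are again above no urelement, while `y` always has an element above one to match
them, an urelement being its own element. -/
theorem le_of_not_hasAtom {v y : USet R} (hv : ¬ HasAtom v) (hy : HasAtom y) : v ≤ y := by
  induction v using mem_induction generalizing y with
  | _ v ih =>
    rcases isSet_or_atom v with hs | ⟨q, rfl⟩
    · obtain ⟨q, hq⟩ := hy
      obtain ⟨y', hy', hq⟩ := atom_le.1 hq
      refine le_iff.2 fun v' hv' => ⟨y', hy', ih v' ((mem_els hs).1 hv') ?_ ⟨q, hq⟩⟩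
      exact fun ⟨p, hp⟩ => hv ⟨p, atom_le.2 ⟨v', hv', hp⟩⟩
    · exact (hv ⟨q, le_rfl⟩).elim

theorem hasAtom_of_transGen {q : R} {v : USet R}
    (h : Relation.TransGen (fun a b => a ∈ b) (atom q) v) : HasAtom v := by
  have key : ∀ {a b : USet R}, a ∈ b → HasAtom a → HasAtom b := fun {a b} h ⟨p, hp⟩ =>
    ⟨p, atom_le.2 ⟨a, .inl h, hp⟩⟩
  induction h with
  | single h => exact key h ⟨q, le_rfl⟩
  | tail _ h ih => exact key h ih

/-- A witness above no urelement would be below some element of `b`. Hence the iterated choice of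
witnesses ends at an urelement and never at the empty set. -/
theorem exists_els_not_le {a b : USet R} (h : ¬ a ≤ b) (hb : HasAtom b) :
    ∃ a' ∈ els a, HasAtom a' ∧ ∀ b' ∈ els b, ¬ a' ≤ b' := by
  rw [le_iff] at h
  push Not at h
  obtain ⟨a', ha', h⟩ := h
  refine ⟨a', ha', ?_, h⟩
  by_contra hcon
  obtain ⟨q, hq⟩ := hb
  obtain ⟨b', hb', hq⟩ := atom_le.1 hq
  exact h b' hb' (le_of_not_hasAtom hcon ⟨q, hq⟩)

open Classical in
/-- A choice of an element of `a` that witnesses `¬ a ≤ b`. -/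
noncomputable def witness (a b : USet R) : USet R :=
  if h : ∃ a' ∈ els a, HasAtom a' ∧ ∀ b' ∈ els b, ¬ a' ≤ b' then h.choose else a

/-- The object reached from the sequence `x` after `k` choices along the infinite set `X`. -/
noncomputable def label (x : ℕ → USet R) : ℕ → Set ℕ → USet R
  | 0, X => x (sInf X)
  | k + 1, X => witness (label x k X) (label x k (X \ {sInf X}))

/-- `x` is a bad sequence of objects that lie above some urelement. -/
structure IsBadSeq (x : ℕ → USet R) : Prop where
  hasAtom : ∀ n, HasAtom (x n)
  not_le : ∀ m n, m < n → ¬ x m ≤ x n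

variable {x : ℕ → USet R}

theorem sInf_lt_of_mem_diff {X : Set ℕ} {n : ℕ} (hn : n ∈ X \ {sInf X}) : sInf X < n :=
  lt_of_le_of_ne (Nat.sInf_le hn.1) (Ne.symm hn.2)

theorem infinite_diff {X : Set ℕ} (hX : X.Infinite) : (X \ {sInf X}).Infinite :=
  hX.sdiff (Set.finite_singleton _)

/-- The next label of `X` is below no element of the current label of the shifted set, and the next
label of the shifted set is such an element. -/
theorem IsBadSeq.label_spec (hx : IsBadSeq x) (k : ℕ) {X : Set ℕ} (hX : X.Infinite) :
    HasAtom (label x k X) ∧ ¬ label x k X ≤ label x k (X \ {sInf X}) := by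
  induction k generalizing X with
  | zero => exact ⟨hx.hasAtom _, hx.not_le _ _
      (sInf_lt_of_mem_diff (Nat.sInf_mem (infinite_diff hX).nonempty))⟩
  | succ k ih =>
    have hw : ∀ {X : Set ℕ}, X.Infinite → label x (k + 1) X ∈ els (label x k X) ∧
        HasAtom (label x (k + 1) X) ∧
        ∀ b ∈ els (label x k (X \ {sInf X})), ¬ label x (k + 1) X ≤ b := fun {X} hX => by
      have h := exists_els_not_le (ih hX).2 (ih (infinite_diff hX)).1
      have e : label x (k + 1) X = h.choose := dif_pos h
      rw [e]
      exact h.choose_spec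
    exact ⟨(hw hX).2.1, (hw hX).2.2 _ (hw (infinite_diff hX)).1⟩

theorem IsBadSeq.label_succ_mem (hx : IsBadSeq x) (k : ℕ) {X : Set ℕ} (hX : X.Infinite) :
    label x (k + 1) X ∈ els (label x k X) := by
  have h := exists_els_not_le (hx.label_spec k hX).2 (hx.label_spec k (infinite_diff hX)).1
  have e : label x (k + 1) X = h.choose := dif_pos h
  rw [e]
  exact h.choose_spec.1

/-- Once an urelement is reached the labels freeze, so labels of `X` and of its shift can be
compared at a common index. -/
theorem IsBadSeq.label_eq_of_le (hx : IsBadSeq x) {j k : ℕ} (hjk : j ≤ k) {X : Set ℕ}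
    (hX : X.Infinite) (h : ¬ (label x j X).IsSet) : label x k X = label x j X := by
  induction k, hjk using Nat.le_induction with
  | base => rfl
  | succ k _ ih =>
    obtain ⟨q, hq⟩ := (isSet_or_atom _).resolve_left h
    have := hx.label_succ_mem k hX
    rw [ih, hq, els_atom] at this
    rw [hq]
    exact this

theorem IsBadSeq.exists_not_isSet (hx : IsBadSeq x) {X : Set ℕ} (hX : X.Infinite) :
    ∃ k, ¬ (label x k X).IsSet := by
  by_contra! h
  exact (wellFounded_iff_isEmpty_descending_chain.1 (mem_wf (Q := R))).false
    ⟨fun k => label x k X, fun k => (mem_els (h k)).1 (hx.label_succ_mem k hX)⟩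

theorem IsBadSeq.rank_label_lt (hx : IsBadSeq x) {j k : ℕ} (hjk : j < k) {X : Set ℕ}
    (hX : X.Infinite) (h : ∀ i ≤ k, (label x i X).IsSet) :
    (label x k X).rank < (label x j X).rank := by
  induction k, (Nat.succ_le_of_lt hjk) using Nat.le_induction with
  | base =>
    exact (rank_le_iff (h j (Nat.le_succ j))).1 le_rfl _
      ((mem_els (h j (Nat.le_succ j))).1 (hx.label_succ_mem j hX)) (h _ le_rfl)
  | succ k hk ih =>
    have hs := h k (Nat.le_succ k)
    exact ((rank_le_iff hs).1 le_rfl _ ((mem_els hs).1 (hx.label_succ_mem k hX))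
      (h _ le_rfl)).trans (ih hk fun i hi => h i (hi.trans (Nat.le_succ k)))

/-- The label of index `k` reads only the first `k + 1` elements, since each step looks one element
further through the shifted set. -/
theorem label_congr (x : ℕ → USet R) (k : ℕ) {σ : Finset ℕ} {X Y : Set ℕ}
    (hX : InitSeg (σ : Set ℕ) X) (hY : InitSeg (σ : Set ℕ) Y) (hk : k < σ.card) :
    label x k X = label x k Y := by
  have hne : (σ : Set ℕ).Nonempty := Finset.card_pos.1 (Nat.zero_lt_of_lt hk)
  have e : sInf X = sInf Y := (hX.sInf_eq hne).trans (hY.sInf_eq hne).symm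
  induction k generalizing σ X Y with
  | zero => simp only [label, e]
  | succ k ih =>
    have hX' := hX.diff_singleton (sInf X)
    have hY' := hY.diff_singleton (sInf X)
    have hc : k < (σ.erase (sInf X)).card := by
      rw [Finset.card_erase_of_mem (Finset.mem_coe.1 (hX.sInf_mem hne))]
      omega
    rw [← Finset.coe_erase] at hX' hY'
    have hne' : ((σ.erase (sInf X) : Finset ℕ) : Set ℕ).Nonempty :=
      Finset.card_pos.1 (Nat.zero_lt_of_lt hc)
    have h₁ := ih hX hY (Nat.lt_of_succ_lt hk) hne e
    have h₂ := ih hX' hY' hc hne' ((hX'.sInf_eq hne').trans (hY'.sInf_eq hne').symm)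
    rw [label, label, h₁, h₂, e]

/-- The finite set `σ` continued by all larger numbers. -/
def extend (σ : Finset ℕ) : Set ℕ := {n | n ∈ σ ∨ ∀ m ∈ σ, m < n}

theorem initSeg_extend (σ : Finset ℕ) : InitSeg (σ : Set ℕ) (extend σ) :=
  ⟨fun _ h => .inl h, fun m hm _ hn => (hn.1.resolve_left hn.2) m hm⟩

theorem infinite_extend (σ : Finset ℕ) : (extend σ).Infinite := fun h => by
  refine Set.infinite_univ (((h.union (Set.finite_Iic (σ.sup id)))).subset fun n _ => ?_)
  rcases le_or_gt n (σ.sup id) with h | h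
  · exact .inr h
  · exact .inl (.inr fun m hm => (Finset.le_sup (f := id) hm).trans_lt h)

/-- The initial segments along which a first urelement is reached. -/
def labelFront (x : ℕ → USet R) : Set (Finset ℕ) :=
  {σ | ∃ k, σ.card = k + 1 ∧ ¬ (label x k (extend σ)).IsSet ∧
    ∀ j < k, (label x j (extend σ)).IsSet}

theorem mem_labelFront_iff {σ : Finset ℕ} {X : Set ℕ} (h : InitSeg (σ : Set ℕ) X) :
    σ ∈ labelFront x ↔
      ∃ k, σ.card = k + 1 ∧ ¬ (label x k X).IsSet ∧ ∀ j < k, (label x j X).IsSet := by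
  refine exists_congr fun k => and_congr_right fun hk => ?_
  have e : ∀ j ≤ k, label x j (extend σ) = label x j X := fun j hj =>
    label_congr x j (initSeg_extend σ) h (by omega)
  rw [e k le_rfl]
  exact and_congr_right' (forall₂_congr fun j hj => by rw [e j hj.le])

theorem IsBadSeq.exists_labelFront (hx : IsBadSeq x) {X : Set ℕ} (hX : X.Infinite) :
    ∃ σ ∈ labelFront x, InitSeg (σ : Set ℕ) X := by
  obtain ⟨k, hk, hmin⟩ := WellFounded.has_min (wellFounded_lt (α := ℕ))
    {k | ¬ (label x k X).IsSet} (hx.exists_not_isSet hX)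
  obtain ⟨σ, hσ, hc⟩ := exists_initSeg_card hX (k + 1)
  exact ⟨σ, (mem_labelFront_iff hσ).2 ⟨k, hc, hk, fun j hj => not_not.1 fun h => hmin j h hj⟩, hσ⟩

theorem IsBadSeq.exists_mem_labelFront (hx : IsBadSeq x) (n : ℕ) : ∃ σ ∈ labelFront x, n ∈ σ := by
  obtain ⟨σ, hσ, h⟩ := hx.exists_labelFront (Set.Ici_infinite n)
  refine ⟨σ, hσ, ?_⟩
  obtain ⟨k, hk, -⟩ := hσ
  have := h.sInf_mem (Finset.card_pos.1 (by omega))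
  rwa [csInf_Ici, Finset.mem_coe] at this

theorem isSet_of_mem_frontTree {σ : Finset ℕ} (h : σ ∈ frontTree (labelFront x)) {X : Set ℕ}
    (hX : InitSeg (σ : Set ℕ) X) {j : ℕ} (hj : j < σ.card) : (label x j X).IsSet := by
  obtain ⟨-, τ, hτ, h₁, hne⟩ := h
  obtain ⟨k, hk, -, hs⟩ := hτ
  have hlt : σ.card < τ.card := Finset.card_lt_card (Finset.ssubset_iff_subset_ne.2
    ⟨Finset.coe_subset.1 h₁.1, hne⟩)
  rw [label_congr x j hX (h₁.trans (initSeg_extend τ)) hj]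
  exact hs j (by omega)

/-- The front of a bad sequence of elements of `V̇_α`. -/
noncomputable def badFront (hx : IsBadSeq x) (α : Ordinal.{u})
    (hα : ∀ n, (x n).IsSet → (x n).rank < α) : RankedFront.{u} where
  carrier := labelFront x
  infinite := infinite_of_forall_mem Set.infinite_univ fun n _ => hx.exists_mem_labelFront n
  antichain σ hσ τ hτ h := by
    obtain ⟨j, hj, hj₁, hj₂⟩ := (mem_labelFront_iff (h.trans (initSeg_extend τ))).1 hσ
    obtain ⟨k, hk, hk₁, hk₂⟩ := hτ
    have : j = k := by
      rcases lt_trichotomy j k with h | h | h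
      · exact (hj₁ (hk₂ j h)).elim
      · exact h
      · exact (hk₁ (hj₂ k h)).elim
    exact Finset.eq_of_subset_of_card_le (Finset.coe_subset.1 h.1) (by omega)
  covers X hX _ := hx.exists_labelFront hX
  -- A nonempty σ determines the labels of index below its cardinality. On the tree the last of
  -- these is still a set, so its rank is meaningful and drops along extensions; the root receives
  -- the bound α.
  rk σ := if σ.1 = ∅ then α else (label x (σ.1.card - 1) (extend σ.1)).rank
  rk_lt σ τ h hne := by
    have hcard : σ.1.card < τ.1.card := Finset.card_lt_card (Finset.ssubset_iff_subset_ne.2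
      ⟨Finset.coe_subset.1 h.1, fun h => hne (Subtype.ext h)⟩)
    have hτ : τ.1 ≠ ∅ := fun h => by simp [h] at hcard
    have hs : ∀ i ≤ τ.1.card - 1, (label x i (extend τ.1)).IsSet := fun i hi =>
      isSet_of_mem_frontTree τ.2 (initSeg_extend _) (by omega)
    rw [if_neg hτ]
    split_ifs with h0
    · refine lt_of_le_of_lt ?_ (hα _ (hs 0 (Nat.zero_le _)))
      rcases Nat.eq_zero_or_pos (τ.1.card - 1) with h | h
      · rw [h]; rfl
      · exact (hx.rank_label_lt h (infinite_extend _) hs).le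
    · have := Finset.card_pos.2 (Finset.nonempty_iff_ne_empty.2 h0)
      rw [label_congr x _ (initSeg_extend σ.1) (h.trans (initSeg_extend τ.1)) (by omega)]
      exact hx.rank_label_lt (by omega) (infinite_extend _) hs

/-- `X` is the minimum of σ followed by an infinite continuation of the longer of τ and σ without
its minimum. -/
theorem exists_infinite_of_shiftRel {σ τ : Finset ℕ} (h : ShiftRel σ τ) :
    ∃ X : Set ℕ, X.Infinite ∧ InitSeg (σ : Set ℕ) X ∧ InitSeg (τ : Set ℕ) (X \ {sInf X}) := by
  obtain ⟨hσ, hτ, hlt, h⟩ := h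
  set m := σ.min' hσ with hm
  have hmσ : m ∈ σ := σ.min'_mem hσ
  obtain ⟨Z, hZ, h₁, h₂, hZm⟩ : ∃ Z : Set ℕ, Z.Infinite ∧
      InitSeg ((σ.erase m : Finset ℕ) : Set ℕ) Z ∧ InitSeg (τ : Set ℕ) Z ∧ ∀ n ∈ Z, m < n := by
    rcases h with h | h
    · refine ⟨extend τ, infinite_extend τ, h.trans (initSeg_extend τ), initSeg_extend τ, ?_⟩
      rintro n (hn | hn)
      · exact hlt.trans_le (τ.min'_le n hn)
      · exact hlt.trans (hn _ (τ.min'_mem hτ))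
    · have h₁ : InitSeg ((σ.erase m : Finset ℕ) : Set ℕ) (extend σ \ {m}) := by
        rw [Finset.coe_erase]
        exact (initSeg_extend σ).diff_singleton m
      refine ⟨extend σ \ {m}, (infinite_extend σ).sdiff (Set.finite_singleton _), h₁,
        InitSeg.trans h h₁, ?_⟩
      rintro n ⟨hn | hn, hne⟩
      · exact lt_of_le_of_ne (σ.min'_le n hn) (Ne.symm hne)
      · exact hn m hmσ
  have hinf : sInf (insert m Z) = m := le_antisymm (Nat.sInf_le (Set.mem_insert _ _)) (by
    rcases Nat.sInf_mem (Set.insert_nonempty m Z) with h | h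
    · exact h.ge
    · exact (hZm _ h).le)
  have hdiff : insert m Z \ {m} = Z := Set.insert_sdiff_self_of_notMem fun h => lt_irrefl _ (hZm m h)
  refine ⟨insert m Z, hZ.mono (Set.subset_insert _ _), ⟨?_, ?_⟩, by rwa [hinf, hdiff]⟩
  · intro n hn
    by_cases hnm : n = m
    · exact .inl hnm
    · exact .inr (h₁.1 (by simpa using ⟨hn, hnm⟩))
  · rintro a ha b ⟨hb, hbσ⟩
    have hbZ : b ∈ Z := hb.resolve_left fun h => hbσ (h ▸ hmσ)
    by_cases ham : a = m
    · exact ham ▸ hZm b hbZ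
    · exact h₁.2 a (by simpa using ⟨ha, ham⟩) b ⟨hbZ, fun h => hbσ (Finset.mem_of_mem_erase h)⟩

/-- If there are no bad arrays of rank `< ζ` with values in `R`, then `V̇_α(R)` is a well quasi-order
for `α < ζ`. -/
theorem isPWO_VDot {ζ α : Ordinal.{u}} (hα : α < ζ)
    (hR : ∀ F : RankedFront.{u}, F.RankLT ζ → ∀ f : F.carrier → R, ¬ BadArray F f) :
    (VDot R α).IsPWO := by
  intro f
  by_contra! hcon
  have hx : IsBadSeq fun n => (f n).1 := by
    refine ⟨fun n => ?_, hcon⟩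
    rcases (f n).2 with ⟨q, hq⟩ | ⟨-, -, q, hq⟩
    · exact ⟨q, hq.ge⟩
    · exact hasAtom_of_transGen hq
  have hrank : ∀ n, (f n).1.IsSet → (f n).1.rank < α := fun n hs => by
    rcases (f n).2 with ⟨q, hq⟩ | ⟨-, h, -⟩
    · exact (not_isSet_atom q (hq ▸ hs)).elim
    · exact h
  let F := badFront hx α hrank
  have hval : ∀ σ : F.carrier, ∃ q : R, ∀ X : Set ℕ, X.Infinite → InitSeg (σ.1 : Set ℕ) X →
      ∃ k, ∀ j ≥ k, label (fun n => (f n).1) j X = atom q := by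
    rintro ⟨σ, k, hk, hs, -⟩
    obtain ⟨q, hq⟩ := (isSet_or_atom _).resolve_left hs
    refine ⟨q, fun X hX h => ⟨k, fun j hj => ?_⟩⟩
    have e := label_congr (fun n => (f n).1) k (initSeg_extend σ) h (by omega)
    rw [hx.label_eq_of_le hj hX (e ▸ hs), ← e, hq]
  choose g hg using hval
  refine hR F ⟨F.empty_mem_frontTree, ?_⟩ g fun σ τ h hle => ?_
  · have e : F.rk ⟨∅, F.empty_mem_frontTree⟩ = α := by simp [F, badFront]
    rwa [e]
  · obtain ⟨X, hX, h₁, h₂⟩ := exists_infinite_of_shiftRel h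
    obtain ⟨j, hj⟩ := hg σ X hX h₁
    obtain ⟨k, hk⟩ := hg τ _ (infinite_diff hX) h₂
    -- At this index the labels of `X` and of its shift are the urelements attached to σ and τ.
    refine (hx.label_spec (max j k) hX).2 ?_
    rw [hj _ (le_max_left _ _), hk _ (le_max_right _ _)]
    exact atom_le_atom.2 hle

end USet

/-! ### Closing the induction on the level. -/

namespace USet

variable {P : Type u} [Preorder P]

theorem fDom_subset {α : Ordinal.{u}} : fDom P α ⊆ WHat P α :=
  fun _ ⟨_, hβ, hx⟩ => IHat_mono hβ hx.1

theorem prod_le_prod_of_sublistForall₂ {α : Ordinal.{u}} {l l' : List (USet (FreeMonoid P))}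
    (h : List.SublistForall₂ (· ≤ ·) l l') (hl : ∀ x ∈ l', x ∈ WHat P α) : l.prod ≤ l'.prod := by
  induction h with
  | nil => simpa using one_le_prod hl
  | cons h _ ih =>
    rw [List.prod_cons, List.prod_cons]
    exact mul_le_mul' h (ih fun x hx => hl x (by simp [hx]))
  | cons_right _ ih =>
    rw [List.prod_cons]
    exact (ih fun x hx => hl x (by simp [hx])).trans (le_mul_left_of_mem (hl _ (by simp)))

theorem isPWO_fDom {α : Ordinal.{u}} (H : PWOBelow P α) (hV : (VDot (P ⊕ Unit) α).IsPWO) :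
    (fDom P α).IsPWO := by
  intro f
  choose v hv _ using fun n => exists_fMap_eq H (f n).2
  obtain ⟨m, n, hmn, hle⟩ := exists_le_of_isPWO hV v fun n => mem_VDot_of_fMap_eq H (f n).2 (hv n)
  exact ⟨m, n, hmn, le_of_fMap_le H (f m).2 (f n).2 (hv m) (hv n) hle⟩

/-- Higman's lemma for lists over the domain of f_α: embedded lists have smaller products because
omitted factors are above 1. -/
theorem isPWO_WHat_of_isPWO_fDom {α : Ordinal.{u}} (H : PWOBelow P α) (hD : (fDom P α).IsPWO) :
    (WHat P α).IsPWO := by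
  intro f
  choose l hl h using fun n => exists_fDom_factors H (f n).2
  obtain ⟨m, n, hmn, hle⟩ :=
    hD.partiallyWellOrderedOn_sublistForall₂ (· ≤ ·) fun n => ⟨l n, hl n⟩
  exact ⟨m, n, hmn, ((h m).1.trans (prod_le_prod_of_sublistForall₂ hle fun x hx =>
    fDom_subset (hl n x hx))).trans (h n).2⟩

/-- The levels below α make f_α total and order-reflecting into a well quasi-order, which in turn
makes level α a well quasi-order. -/
theorem isPWO_WHat {ζ α : Ordinal.{u}} (hP : IsOrdWqo ζ P) (hα : α < ζ) : (WHat P α).IsPWO := by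
  induction α using WellFoundedLT.induction with
  | _ α ih =>
    have H : PWOBelow P α := fun δ hδ => ih δ hδ (hδ.trans hα)
    exact isPWO_WHat_of_isPWO_fDom H
      (isPWO_fDom H (isPWO_VDot hα fun F hF => not_badArray_sum hP.2 F hF))

end USet

theorem mainTheorem4 {P : Type u} [Preorder P] (ζ : Ordinal.{u}) (hP : IsOrdWqo ζ P)
    (α : Ordinal.{u}) (hα : α < ζ) :
    (∀ x ∈ fDom P α, fMap P α x ≠ none) ∧
    ((∀ x ∈ fDom P α, ∀ v, fMap P α x = some v → v ∈ USet.VDot (P ⊕ Unit) α) ∧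
      (∀ x ∈ fDom P α, ∀ y ∈ fDom P α, ∀ v w, fMap P α x = some v → fMap P α y = some w →
        v ≤ w → x ≤ y)) ∧
    ((∀ x ∈ USet.IHat (Set.univ : Set (FreeMonoid P)) α,
        ∀ y ∈ USet.IHat (Set.univ : Set (FreeMonoid P)) α, (USet.hatMul α x y).Equi (x * y)) ∧
      IsMultiplicativeQo (USet.IHat (Set.univ : Set (FreeMonoid P)) α) (· ≤ ·)
        (USet.hatMul α)) ∧
    HasPlusProperty (USet.IHat (Set.univ : Set (FreeMonoid P)) α) (· ≤ ·) (USet.hatMul α) ∧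
    (∀ x ∈ USet.IHat (Set.univ : Set (FreeMonoid P)) α,
      ∃ l : List (USet (FreeMonoid P)), (∀ p ∈ l, p ∈ USet.Prim (FreeMonoid P) α) ∧
        x.Equi (USet.hatProd α l)) := by
  have H : USet.PWOBelow P α := fun δ hδ => USet.isPWO_WHat hP (hδ.trans hα)
  refine ⟨fun x hx h => ?_, ⟨fun x hx v hv => mem_VDot_of_fMap_eq H hx hv,
    fun x hx y hy v w hv hw hle => le_of_fMap_le H hx hy hv hw hle⟩,
    ⟨fun x hx y hy => USet.hatMul_equi H hx hy, USet.isMultiplicativeQo_WHat H⟩,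
    USet.hasPlusProperty_WHat H, fun x hx => ?_⟩
  · obtain ⟨v, hv, -⟩ := exists_fMap_eq H hx
    rw [h] at hv
    exact Option.some_ne_none v hv.symm
  · obtain ⟨l, hl, h⟩ := USet.exists_prim_factors H
      (USet.wellFoundedOn_of_isPWO (USet.isPWO_WHat hP hα)) hx
    exact ⟨l, hl, h.trans (USet.hatProd_spec H l fun p hp => (hl p hp).1).2.symm⟩
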